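/- Let $P$ be a non-empty set of propositional atoms and $A$ a non-empty finite set of agents. **Action models and their logic.** The language $\mathcal L$ of modal logic is $\phi ::= p \mid \neg\phi \mid \phi\wedge\phi \mid \Box_a\phi$ ($p \in P$, $a \in A$), and $\vdash_{\mathbf{S5}}$ denotes provability in multi-agent $\mathbf{S5}$. The language $\mathcal L_{AAML}$ is $$\phi ::= p \mid \neg\phi \mid \phi\wedge\phi \mid \Box_a\phi \mid [\mathsf M_{\mathsf T}]\phi \mid \forall\phi,$$ where $\mathsf M_{\mathsf T}$ is an S5 action model: a finite non-empty set of points with an equivalence relation $\mathsf R_a$ for each agent $a$, a precondition $\mathsf{pre}(\mathsf t)\in\mathcal L_{AAML}$ for each point $\mathsf t$, and a set $\mathsf T$ of designated points; $\forall$ is the refinement quantifier. We use the usual abbreviations, $\Diamond_a\phi=\neg\Box_a\neg\phi$, $\langle\mathsf M_{\mathsf T}\rangle\phi=\neg[\mathsf M_{\mathsf T}]\neg\phi$, $\exists\phi=\neg\forall\neg\phi$, and $\nabla_a\Gamma=\Box_a\bigvee_{\gamma\in\Gamma}\gamma\wedge\bigwedge_{\gamma\in\Gamma}\Diamond_a\gamma$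 for finite $\Gamma\subseteq\mathcal L$. The sequential execution $\mathsf M_{\mathsf T}\otimes\mathsf M'_{\mathsf T'}$ has as points the pairs $(\mathsf s,\mathsf s')$, componentwise accessibility, preconditions $\langle\mathsf M_{\mathsf s}\rangle\mathsf{pre}'(\mathsf s')$ and designated points $\mathsf T\times\mathsf T'$. Let $B\subseteq A$, $\gamma^0\in\mathcal L$, and $\Gamma_a\subseteq\mathcal L$ finite with $\gamma^0\in\Gamma_a$ for $a\in B$; let $\Psi$ be the set of all subformulae of members of $\bigcup_{a\in B}\Gamma_a$. Call $\gamma^0\wedge\bigwedge_{a\in B}\nabla_a\Gamma_a$ *explicit* if for all $a\in B$ and $\gamma\in\Gamma_a$: (i) for every $\psi\in\Psi$, $\vdash_{\mathbf{S5}}\gamma\to\psi$ or $\vdash_{\mathbf{S5}}\gamma\to\neg\psi$; (ii) for every $\Box_a\psi\in\Psi$, $\vdash_{\mathbf{S5}}\gamma\to\Box_a\psi$ if and only if $\vdash_{\mathbf{S5}}\gamma'\to\psi$ for all $\gamma'\in\Gamma_a$. Provability $\vdash$ on $\mathcal L_{AAML}$ is given by: all instances of propositional tautologies; the axioms K, T,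 4, 5 for each $\Box_a$; modus ponens; necessitation for each $\Box_a$, each $[\mathsf M_{\mathsf T}]$ and $\forall$; and the axioms - $[\mathsf M_{\mathsf T}\otimes\mathsf M'_{\mathsf T'}]\phi\leftrightarrow[\mathsf M_{\mathsf T}][\mathsf M'_{\mathsf T'}]\phi$ and $[\mathsf M_{\mathsf T}]\phi\leftrightarrow\bigwedge_{\mathsf t\in\mathsf T}[\mathsf M_{\mathsf t}]\phi$; - $[\mathsf M_{\mathsf t}]p\leftrightarrow(\mathsf{pre}(\mathsf t)\to p)$ and $[\mathsf M_{\mathsf t}]\neg\phi\leftrightarrow(\mathsf{pre}(\mathsf t)\to\neg[\mathsf M_{\mathsf t}]\phi)$; - $[\mathsf M_{\mathsf t}](\phi\wedge\psi)\leftrightarrow([\mathsf M_{\mathsf t}]\phi\wedge[\mathsf M_{\mathsf t}]\psi)$; - $[\mathsf M_{\mathsf t}]\Box_a\phi\leftrightarrow(\mathsf{pre}(\mathsf t)\to\Box_a[\mathsf M_{\mathsf t\mathsf R_a}]\phi)$, where $\mathsf t\mathsf R_a=\{\mathsf u\mid\mathsf t\,\mathsf R_a\,\mathsf u\}$; - $\forall(\phi\to\psi)\to(\forall\phi\to\forall\psi)$,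 and $\forall\pi\leftrightarrow\pi$ for propositional $\pi$; - $\exists(\gamma^0\wedge\nabla_a\Gamma_a)\leftrightarrow\exists\gamma^0\wedge\bigwedge_{\gamma\in\Gamma_a}\Diamond_a\exists\gamma$ if $\gamma^0\wedge\nabla_a\Gamma_a$ is explicit ($B=\{a\}$); - $\exists(\gamma^0\wedge\bigwedge_{a\in A}\nabla_a\Gamma_a)\leftrightarrow\bigwedge_{a\in A}\exists(\gamma^0\wedge\nabla_a\Gamma_a)$ if $\gamma^0\wedge\bigwedge_{a\in A}\nabla_a\Gamma_a$ is explicit ($B=A$). **Action formulae.** The languages $\mathcal L_{AFL}$ of action formula logic and $\mathcal L_{AFL}^{act}$ of action formulae are defined simultaneously by $$\phi ::= p \mid \neg\phi \mid \phi\wedge\phi \mid \Box_a\phi \mid [\alpha]\phi,\qquad \alpha ::= {?\phi} \mid \alpha\sqcup\alpha \mid \alpha\otimes\alpha \mid L_B(\alpha,\alpha)\quad(\emptyset\ne B\subseteq A),$$ with $\langle\alpha\rangle\phi=\neg[\alpha]\neg\phi$. Each action formula $\alpha$ stands for an S5 action model $\tau(\alpha)$: - $\tau(?\phi)$ has a designated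 point with precondition $\phi$ and a further point with precondition $\top$, and no agent distinguishes the two; - $\tau(\alpha\sqcup\beta)$ is the disjoint union of $\tau(\alpha)$ and $\tau(\beta)$, and $\tau(\alpha\otimes\beta)$ is their sequential execution; - $\tau(L_B(\alpha,\beta))$ is obtained from the disjoint union of $\tau(\alpha)$ and $\tau(\beta)$ by adding, for each designated point $\mathsf t$ of either, a new proxy point $\bar{\mathsf t}$ with the precondition of $\mathsf t$; for $a\in B$ all proxies form one new $a$-class, for $a\notin B$ each $\bar{\mathsf t}$ joins the $a$-class of $\mathsf t$; the designated points are the proxies of the designated points of $\tau(\alpha)$. A formula that contains action formulae is called provable if the $\mathcal L_{AAML}$-formula that results from replacing each action formula $\alpha$ in it by $\tau(\alpha)$ is provable. **Proposition.** For every $\phi\in\mathcal L_{AFL}$ there is an action formula $\alpha\in\mathcal L_{AFL}^{act}$ such that $$\vdash[\alpha]\phi\qquad\text{and}\qquad\vdash\exists\phi\to\langle\alpha\rangle\phi.$$ -/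

import Mathlib

universe u v

namespace AFL

/-! ## The modal language and the axiomatisation of S5 -/

/-- The language of (multi-agent) modal logic over atoms `P` and agents `A`. -/
inductive ModalForm (P : Type u) (A : Type v) : Type (max u v)
  | atom (p : P) : ModalForm P A
  | neg (φ : ModalForm P A) : ModalForm P A
  | and (φ ψ : ModalForm P A) : ModalForm P A
  | box (a : A) (φ : ModalForm P A) : ModalForm P A

namespace ModalForm

variable {P : Type u} {A : Type v}

/-- Implication, as the usual abbreviation. -/
def imp (φ ψ : ModalForm P A) : ModalForm P A := neg (and φ (neg ψ))

/-- Instances of propositional tautologies: formulae that hold under every assignment of truth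
values to all formulae that respects negation and conjunction. -/
def Taut (χ : ModalForm P A) : Prop :=
  ∀ v : ModalForm P A → Prop, (∀ φ, v (neg φ) ↔ ¬ v φ) →
    (∀ φ ψ, v (and φ ψ) ↔ (v φ ∧ v ψ)) → v χ

/-- Provability in the axiomatisation of S5. -/
inductive ProvesS5 : ModalForm P A → Prop
  | taut {φ} : Taut φ → ProvesS5 φ
  | axK (a : A) (φ ψ) : ProvesS5 ((box a (φ.imp ψ)).imp ((box a φ).imp (box a ψ)))
  | axT (a : A) (φ) : ProvesS5 ((box a φ).imp φ)
  | ax4 (a : A) (φ) : ProvesS5 ((box a φ).imp (box a (box a φ)))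
  | ax5 (a : A) (φ) : ProvesS5 ((neg (box a φ)).imp (box a (neg (box a φ))))
  | mp {φ ψ} : ProvesS5 (φ.imp ψ) → ProvesS5 φ → ProvesS5 ψ
  | nec (a : A) {φ} : ProvesS5 φ → ProvesS5 (box a φ)

/-- The set of subformulae of a formula (including the formula itself). -/
def subs : ModalForm P A → Set (ModalForm P A)
  | atom p => {atom p}
  | neg φ => insert (neg φ) φ.subs
  | and φ ψ => insert (and φ ψ) (φ.subs ∪ ψ.subs)
  | box a φ => insert (box a φ) φ.subs

/-- The condition for `π ∧ γ₀ ∧ ⋀_{a ∈ B} ∇_a (Γ a)`, with `π` any propositional formula, to be an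
explicit formula with respect to the agents in `B`. Here `Ψ` is the set of all subformulae of
members of the sets `Γ a`, `a ∈ B`. -/
def Explicit (B : Set A) (γ₀ : ModalForm P A) (Γ : A → Finset (ModalForm P A)) : Prop :=
  let Ψ : Set (ModalForm P A) := {ψ | ∃ a ∈ B, ∃ γ ∈ Γ a, ψ ∈ γ.subs}
  (∀ a ∈ B, γ₀ ∈ Γ a) ∧
  (∀ a ∈ B, ∀ γ ∈ Γ a, ∀ ψ ∈ Ψ, ProvesS5 (γ.imp ψ) ∨ ProvesS5 (γ.imp (neg ψ))) ∧
  (∀ a ∈ B, ∀ γ ∈ Γ a, ∀ ψ, box a ψ ∈ Ψ →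
    (ProvesS5 (γ.imp (box a ψ)) ↔ ∀ γ' ∈ Γ a, ProvesS5 (γ'.imp ψ)))

end ModalForm

/-! ## Arbitrary action model logic over S5 -/

/-- The frame of an S5 action model: a finite non-empty set of action points with one equivalence
relation for each agent. -/
structure ActFrame (A : Type v) : Type (max v 1) where
  pt : Type
  finite : Finite pt
  nonempty : Nonempty pt
  rel : A → pt → pt → Prop
  equiv : ∀ a, Equivalence (rel a)

/-- The language of arbitrary action model logic, restricted to S5 action models. In `act F pre T φ`
the action model has frame `F`, preconditions `pre` and designated points `T`; the formula is
`[(F, pre)_T] φ`. The last constructor is the universal refinement quantifier. -/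
inductive Form (P : Type u) (A : Type v) : Type (max u v 1)
  | atom (p : P) : Form P A
  | neg (φ : Form P A) : Form P A
  | and (φ ψ : Form P A) : Form P A
  | box (a : A) (φ : Form P A) : Form P A
  | act (F : ActFrame A) (pre : F.pt → Form P A) (T : Set F.pt) (φ : Form P A) : Form P A
  | allRef (φ : Form P A) : Form P A

/-- A multi-pointed S5 action model with preconditions in the language `Form P A`. -/
structure ActModel (P : Type u) (A : Type v) : Type (max u v 1) where
  frame : ActFrame A
  pre : frame.pt → Form P A
  pts : Set frame.pt

namespace Form

variable {P : Type u} {A : Type v}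

def imp (φ ψ : Form P A) : Form P A := neg (and φ (neg ψ))

def or (φ ψ : Form P A) : Form P A := neg (and (neg φ) (neg ψ))

def iff (φ ψ : Form P A) : Form P A := and (imp φ ψ) (imp ψ φ)

def dia (a : A) (φ : Form P A) : Form P A := neg (box a (neg φ))

/-- The existential refinement quantifier. -/
def someRef (φ : Form P A) : Form P A := neg (allRef (neg φ))

noncomputable def top [Nonempty P] : Form P A :=
  or (atom (Classical.arbitrary P)) (neg (atom (Classical.arbitrary P)))

noncomputable def bot [Nonempty P] : Form P A := neg top

/-- The conjunction of `f i` for `i` in a finite set. -/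
noncomputable def bigAnd [Nonempty P] {ι : Type*} (s : Finset ι) (f : ι → Form P A) : Form P A :=
  (s.toList.map f).foldr and top

/-- The disjunction of `f i` for `i` in a finite set. -/
noncomputable def bigOr [Nonempty P] {ι : Type*} (s : Finset ι) (f : ι → Form P A) : Form P A :=
  (s.toList.map f).foldr or bot

/-- `[M] φ` for a multi-pointed action model `M`. -/
def allAct (M : ActModel P A) (φ : Form P A) : Form P A := act M.frame M.pre M.pts φ

/-- `⟨M⟩ φ` for a multi-pointed action model `M`. -/
def someAct (M : ActModel P A) (φ : Form P A) : Form P A := neg (allAct M (neg φ))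

/-- The formulae of propositional logic. -/
def IsProp : Form P A → Prop
  | atom _ => True
  | neg φ => φ.IsProp
  | and φ ψ => φ.IsProp ∧ ψ.IsProp
  | _ => False

/-- The inclusion of the modal language. -/
def ofModal : ModalForm P A → Form P A
  | .atom p => atom p
  | .neg φ => neg (ofModal φ)
  | .and φ ψ => and (ofModal φ) (ofModal ψ)
  | .box a φ => box a (ofModal φ)

/-- The cover operator `∇_a Γ` for a finite set `Γ` of modal formulae. -/
noncomputable def cover [Nonempty P] (a : A) (Γ : Finset (ModalForm P A)) : Form P A :=
  and (box a (bigOr Γ ofModal)) (bigAnd Γ fun γ => dia a (ofModal γ))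

/-- Instances of propositional tautologies. -/
def Taut (χ : Form P A) : Prop :=
  ∀ v : Form P A → Prop, (∀ φ, v (neg φ) ↔ ¬ v φ) →
    (∀ φ ψ, v (and φ ψ) ↔ (v φ ∧ v ψ)) → v χ

end Form

namespace ActModel

variable {P : Type u} {A : Type v}

/-- The same action model with designated points `T`. -/
def withPts (M : ActModel P A) (T : Set M.frame.pt) : ActModel P A := ⟨M.frame, M.pre, T⟩

/-- Sequential execution of action models: first `M`, then `N`. -/
def seq (M N : ActModel P A) : ActModel P A where
  frame :=
    { pt := M.frame.pt × N.frame.pt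
      finite := by
        have := M.frame.finite
        have := N.frame.finite
        infer_instance
      nonempty := by
        have := M.frame.nonempty
        have := N.frame.nonempty
        infer_instance
      rel := fun a x y => M.frame.rel a x.1 y.1 ∧ N.frame.rel a x.2 y.2
      equiv := fun a =>
        ⟨fun x => ⟨(M.frame.equiv a).refl x.1, (N.frame.equiv a).refl x.2⟩,
         fun h => ⟨(M.frame.equiv a).symm h.1, (N.frame.equiv a).symm h.2⟩,
         fun h k => ⟨(M.frame.equiv a).trans h.1 k.1, (N.frame.equiv a).trans h.2 k.2⟩⟩ }
  pre := fun x => Form.someAct (M.withPts {x.1}) (N.pre x.2)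
  pts := M.pts ×ˢ N.pts

/-- The action model of a test: points `true` (test) and `false` (skip), which no agent can
tell apart. -/
noncomputable def test [Nonempty P] (φ : Form P A) : ActModel P A where
  frame :=
    { pt := Bool
      finite := inferInstance
      nonempty := inferInstance
      rel := fun _ _ _ => True
      equiv := fun _ => ⟨fun _ => trivial, fun _ => trivial, fun _ _ => trivial⟩ }
  pre := fun x => if x then φ else Form.top
  pts := {true}

/-- The action model of a non-deterministic choice: the disjoint union. -/
def choice (M N : ActModel P A) : ActModel P A where
  frame :=
    { pt := M.frame.pt ⊕ N.frame.pt
      finite := by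
        have := M.frame.finite
        have := N.frame.finite
        infer_instance
      nonempty := by
        have := M.frame.nonempty
        infer_instance
      rel := fun a => Sum.LiftRel (M.frame.rel a) (N.frame.rel a)
      equiv := fun a => by
        refine ⟨?_, ?_, ?_⟩
        · rintro (x | x)
          · exact .inl ((M.frame.equiv a).refl x)
          · exact .inr ((N.frame.equiv a).refl x)
        · rintro _ _ (h | h)
          · exact .inl ((M.frame.equiv a).symm h)
          · exact .inr ((N.frame.equiv a).symm h)
        · rintro _ _ _ (h | h) (k | k)
          · exact .inl ((M.frame.equiv a).trans h k)
          · exact .inr ((N.frame.equiv a).trans h k) }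
  pre := Sum.elim M.pre N.pre
  pts := Sum.inl '' M.pts ∪ Sum.inr '' N.pts

/-- The points of the action model of learning: all points of `U`, and a new proxy point for each
designated point of `U`. -/
abbrev LearnPt (U : ActModel P A) : Type := U.frame.pt ⊕ {t : U.frame.pt // t ∈ U.pts}

/-- A point of `U` is sent to itself and a proxy to the point that it is the proxy of. -/
def LearnPt.base {U : ActModel P A} : LearnPt U → U.frame.pt := Sum.elim id Subtype.val

/-- The accessibility relations of the action model of learning. For an agent in `B`, all proxies
are related to each other, and to nothing else. For an agent outside `B`, the proxy of `t` joins
the equivalence class of `t`. The relations between points of `U` do not change. -/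
def LearnRel (B : Set A) (U : ActModel P A) (a : A) (x y : LearnPt U) : Prop :=
  (a ∈ B ∧ Sum.LiftRel (U.frame.rel a) (fun _ _ => True) x y) ∨
  (a ∉ B ∧ U.frame.rel a x.base y.base)

theorem learnRel_equiv (B : Set A) (U : ActModel P A) (a : A) :
    Equivalence (LearnRel B U a) := by
  have e := U.frame.equiv a
  refine ⟨?_, ?_, ?_⟩
  · intro x
    by_cases h : a ∈ B
    · refine .inl ⟨h, ?_⟩
      rcases x with x | x
      · exact .inl (e.refl x)
      · exact .inr trivial
    · exact .inr ⟨h, e.refl _⟩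
  · rintro x y (⟨h, k⟩ | ⟨h, k⟩)
    · refine .inl ⟨h, ?_⟩
      rcases k with k | k
      · exact .inl (e.symm k)
      · exact .inr trivial
    · exact .inr ⟨h, e.symm k⟩
  · rintro x y z (⟨h, k⟩ | ⟨h, k⟩) (⟨h', l⟩ | ⟨h', l⟩)
    · refine .inl ⟨h, ?_⟩
      rcases k with k | k <;> rcases l with l | l
      · exact .inl (e.trans k l)
      · exact .inr trivial
    · exact absurd h h'
    · exact absurd h' h
    · exact .inr ⟨h, e.trans k l⟩

/-- The action model of the agents in `B` learning that `M` or `N` occurred, when in fact `M`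
occurred. Its points are those of the disjoint union of `M` and `N` together with the proxies of
all designated points of `M` and `N`; its designated points are the proxies of those of `M`. -/
def learn (B : Set A) (M N : ActModel P A) : ActModel P A where
  frame :=
    { pt := LearnPt (M.choice N)
      finite := by
        have := (M.choice N).frame.finite
        infer_instance
      nonempty := by
        have := (M.choice N).frame.nonempty
        infer_instance
      rel := LearnRel B (M.choice N)
      equiv := learnRel_equiv B (M.choice N) }
  pre := fun x => (M.choice N).pre x.base
  pts := {x | ∃ (t : M.frame.pt) (ht : t ∈ M.pts),
    x = Sum.inr ⟨Sum.inl t, Or.inl (Set.mem_image_of_mem Sum.inl ht)⟩}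

/-- The designated points of an action model as a `Finset`. -/
noncomputable def ptsFinset (M : ActModel P A) : Finset M.frame.pt :=
  haveI := M.frame.finite
  (Set.toFinite M.pts).toFinset

end ActModel

open Form in
/-- Provability in the axiomatisation of arbitrary action model logic over S5: the axioms and rules
of S5, the reduction axioms and necessitation for action models, and the axioms and necessitation
for refinement quantifiers. -/
inductive Provable {P : Type u} {A : Type v} [Nonempty P] [Fintype A] : Form P A → Prop
  | taut {φ : Form P A} : Taut φ → Provable φ
  | axK (a : A) (φ ψ : Form P A) :
      Provable (imp (box a (imp φ ψ)) (imp (box a φ) (box a ψ)))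
  | axT (a : A) (φ : Form P A) : Provable (imp (box a φ) φ)
  | ax4 (a : A) (φ : Form P A) : Provable (imp (box a φ) (box a (box a φ)))
  | ax5 (a : A) (φ : Form P A) : Provable (imp (neg (box a φ)) (box a (neg (box a φ))))
  | mp {φ ψ : Form P A} : Provable (imp φ ψ) → Provable φ → Provable ψ
  | nec (a : A) {φ : Form P A} : Provable φ → Provable (box a φ)
  | axAS (M N : ActModel P A) (φ : Form P A) :
      Provable (iff (allAct (M.seq N) φ) (allAct M (allAct N φ)))
  | axAU (M : ActModel P A) (φ : Form P A) :
      Provable (iff (allAct M φ) (bigAnd M.ptsFinset fun t => allAct (M.withPts {t}) φ))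
  | axAP (M : ActModel P A) (t : M.frame.pt) (p : P) :
      Provable (iff (allAct (M.withPts {t}) (atom p)) (imp (M.pre t) (atom p)))
  | axAN (M : ActModel P A) (t : M.frame.pt) (φ : Form P A) :
      Provable (iff (allAct (M.withPts {t}) (neg φ))
        (imp (M.pre t) (neg (allAct (M.withPts {t}) φ))))
  | axAC (M : ActModel P A) (t : M.frame.pt) (φ ψ : Form P A) :
      Provable (iff (allAct (M.withPts {t}) (and φ ψ))
        (and (allAct (M.withPts {t}) φ) (allAct (M.withPts {t}) ψ)))
  | axAK (M : ActModel P A) (t : M.frame.pt) (a : A) (φ : Form P A) :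
      Provable (iff (allAct (M.withPts {t}) (box a φ))
        (imp (M.pre t) (box a (allAct (M.withPts {u | M.frame.rel a t u}) φ))))
  | necA (M : ActModel P A) {φ : Form P A} : Provable φ → Provable (allAct M φ)
  | axR (φ ψ : Form P A) :
      Provable (imp (allRef (imp φ ψ)) (imp (allRef φ) (allRef ψ)))
  | axRP {π : Form P A} : IsProp π → Provable (iff (allRef π) π)
  | axRS5 (a : A) (γ₀ : ModalForm P A) (Γ : A → Finset (ModalForm P A)) :
      ModalForm.Explicit {a} γ₀ Γ →
      Provable (iff (someRef (and (ofModal γ₀) (cover a (Γ a))))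
        (and (someRef (ofModal γ₀)) (bigAnd (Γ a) fun γ => dia a (someRef (ofModal γ)))))
  | axRDist (γ₀ : ModalForm P A) (Γ : A → Finset (ModalForm P A)) :
      ModalForm.Explicit Set.univ γ₀ Γ →
      Provable (iff
        (someRef (and (ofModal γ₀) (bigAnd Finset.univ fun a => cover a (Γ a))))
        (bigAnd Finset.univ fun a => someRef (and (ofModal γ₀) (cover a (Γ a)))))
  | necR {φ : Form P A} : Provable φ → Provable (allRef φ)

/-! ## Arbitrary action formula logic -/

mutual

/-- The language of arbitrary action formula logic. -/
inductive AFForm (P : Type u) (A : Type v) : Type (max u v)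
  | atom (p : P) : AFForm P A
  | neg (φ : AFForm P A) : AFForm P A
  | and (φ ψ : AFForm P A) : AFForm P A
  | box (a : A) (φ : AFForm P A) : AFForm P A
  | allAct (α : AFAct P A) (φ : AFForm P A) : AFForm P A
  | allRef (φ : AFForm P A) : AFForm P A

/-- The language of arbitrary action formulae: tests, non-deterministic choice, sequential
execution, and learning by a non-empty set of agents. -/
inductive AFAct (P : Type u) (A : Type v) : Type (max u v)
  | test (φ : AFForm P A) : AFAct P A
  | choice (α β : AFAct P A) : AFAct P A
  | seq (α β : AFAct P A) : AFAct P A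
  | learn (B : Set A) (hB : B.Nonempty) (α β : AFAct P A) : AFAct P A

end

section

variable {P : Type u} {A : Type v}

mutual

/-- The formulae of action formula logic: those without refinement quantifiers. -/
def AFForm.RefFree : AFForm P A → Prop
  | .atom _ => True
  | .neg φ => φ.RefFree
  | .and φ ψ => φ.RefFree ∧ ψ.RefFree
  | .box _ φ => φ.RefFree
  | .allAct α φ => α.RefFree ∧ φ.RefFree
  | .allRef _ => False

/-- The action formulae without refinement quantifiers. -/
def AFAct.RefFree : AFAct P A → Prop
  | .test φ => φ.RefFree
  | .choice α β => α.RefFree ∧ β.RefFree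
  | .seq α β => α.RefFree ∧ β.RefFree
  | .learn _ _ α β => α.RefFree ∧ β.RefFree

end

mutual

/-- The translation of formulae that replaces each action formula by its S5 action model. -/
noncomputable def AFForm.toForm [Nonempty P] : AFForm P A → Form P A
  | .atom p => .atom p
  | .neg φ => .neg φ.toForm
  | .and φ ψ => .and φ.toForm ψ.toForm
  | .box a φ => .box a φ.toForm
  | .allAct α φ => Form.allAct α.toModel φ.toForm
  | .allRef φ => .allRef φ.toForm

/-- The S5 action model that an action formula stands for. -/
noncomputable def AFAct.toModel [Nonempty P] : AFAct P A → ActModel P A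
  | .test φ => ActModel.test φ.toForm
  | .choice α β => ActModel.choice α.toModel β.toModel
  | .seq α β => ActModel.seq α.toModel β.toModel
  | .learn B _ α β => ActModel.learn B α.toModel β.toModel

end

namespace AFForm

def imp (φ ψ : AFForm P A) : AFForm P A := neg (and φ (neg ψ))

/-- `⟨α⟩ φ`. -/
def someAct (α : AFAct P A) (φ : AFForm P A) : AFForm P A := neg (allAct α (neg φ))

/-- The existential refinement quantifier. -/
def someRef (φ : AFForm P A) : AFForm P A := neg (allRef (neg φ))

/-- Provability in S5 of a formula of arbitrary action formula logic: provability in arbitrary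
action model logic over S5, reading each action formula as its action model. -/
def Proves [Nonempty P] [Fintype A] (φ : AFForm P A) : Prop := Provable φ.toForm

end AFForm

end

end AFL

/-!
Up to a finite set of atoms and a modal depth `k`, a formula only depends on the type of the world
at which it is evaluated: the atoms that are true there, and, up to depth `k`, the types that each
agent considers possible. There are finitely many types of depth `k`. Since the reduction axioms
eliminate action models, it suffices, for each type `τ` of a world at which `φ` is true, to
synthesise an action formula whose results all have type `τ` and which can be executed wherever
some refinement has type `τ`; `α` is the choice between these action formulae.

The characteristic formula of a type is an explicit conjunction of cover formulae, so by the
refinement axioms `∃ χ_τ` implies a modal formula which says, hereditarily, that the atoms of `τ`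
hold and that each type that an agent considers possible in `τ` is realised by a refinement of some
world that the agent considers possible. To synthesise a type `τ` of depth `k + 1`, start with an
action formula for the part of `τ` of depth `k`, and let each agent `b` in turn learn to be in
the class of the results of the action formulae for the members of `τ_b`. Learning `L_b` leaves the
other agents at the proxies where they were, and changes nothing at depth `k`, because in an S5
model all worlds in a class agree on that class, and because `τ` itself, at depth `k`, belongs to
`τ_b`.
-/

namespace AFL

/-! ## Propositional theories and maximal consistent sets -/

section Theories

variable {F : Type*} {neg : F → F} {and : F → F → F} {box : F → F} {D v : F → Prop} {φ : F}

/-- Assignments of truth values to the formulae of a language that respect its negation `neg` and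
its conjunction `and`. -/
structure IsValuation (neg : F → F) (and : F → F → F) (v : F → Prop) : Prop where
  neg_iff (φ : F) : v (neg φ) ↔ ¬ v φ
  and_iff (φ ψ : F) : v (and φ ψ) ↔ v φ ∧ v ψ

theorem IsValuation.imp_iff (hv : IsValuation neg and v) (φ ψ : F) :
    v (neg (and φ (neg ψ))) ↔ (v φ → v ψ) := by
  rw [hv.neg_iff, hv.and_iff, hv.neg_iff, not_and_not_right]

/-- Sets of formulae, given as predicates, that contain all propositional tautologies and are
closed under modus ponens. -/
structure IsTheory (neg : F → F) (and : F → F → F) (D : F → Prop) : Prop where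
  taut {φ : F} : (∀ v, IsValuation neg and v → v φ) → D φ
  mp {φ ψ : F} : D (neg (and φ (neg ψ))) → D φ → D ψ

/-- Maximal consistent extensions of a theory `D`, in the guise of the valuations that make `D`
true. -/
structure IsMaxConsistent (neg : F → F) (and : F → F → F) (D v : F → Prop) : Prop
    extends IsValuation neg and v where
  of_mem {φ : F} : D φ → v φ

/-- Modalities that are normal with respect to a theory `D`: they satisfy the axiom K and the rule
of necessitation. -/
structure IsNormal (neg : F → F) (and : F → F → F) (D : F → Prop) (box : F → F) : Prop where
  axK (φ ψ : F) : D (neg (and (box (neg (and φ (neg ψ))))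
    (neg (neg (and (box φ) (neg (box ψ)))))))
  nec {φ : F} : D φ → D (box φ)

theorem exists_finset_entails_of_entails (h : ∀ v, IsMaxConsistent neg and D v → v φ) :
    ∃ s : Finset {ψ // D ψ}, ∀ v, IsValuation neg and v → (∀ ψ ∈ s, v ψ) → v φ := by
  by_contra! hs
  choose v hv hvD hφ using hs
  -- The ultraproduct of counterexamples to the finite entailments.
  let U := Ultrafilter.of (Filter.atTop : Filter (Finset {ψ // D ψ}))
  have hU : IsMaxConsistent neg and D fun χ => ∀ᶠ s in U, v s χ :=
    { neg_iff := fun χ => by simp only [(hv _).neg_iff, Ultrafilter.eventually_not]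
      and_iff := fun χ χ' => by simp only [(hv _).and_iff, Filter.eventually_and]
      of_mem := fun {χ} hχ => Ultrafilter.of_le _ <|
        (Filter.eventually_ge_atTop {⟨χ, hχ⟩}).mono fun s hs =>
          hvD s ⟨χ, hχ⟩ (Finset.singleton_subset_iff.1 hs) }
  obtain ⟨s, hs⟩ := (h _ hU).exists
  exact hφ s hs

namespace IsTheory

theorem mem_of_finset_entails (hD : IsTheory neg and D) (s : Finset {ψ // D ψ})
    (h : ∀ v, IsValuation neg and v → (∀ ψ ∈ s, v ψ) → v φ) : D φ := by
  classical
  induction s using Finset.induction_on generalizing φ with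
  | empty => exact hD.taut fun v hv => h v hv (by simp)
  | insert ψ s _ ih =>
    refine hD.mp (ih fun v hv hs => (hv.imp_iff ψ φ).2 fun hψ => h v hv ?_) ψ.2
    exact (Finset.forall_mem_insert _ _ _).2 ⟨hψ, hs⟩

theorem mem_of_forall_isMaxConsistent (hD : IsTheory neg and D)
    (h : ∀ v, IsMaxConsistent neg and D v → v φ) : D φ :=
  have ⟨s, hs⟩ := exists_finset_entails_of_entails h
  hD.mem_of_finset_entails s hs

theorem preimage_normal (hD : IsTheory neg and D) (hbox : IsNormal neg and D box)
    (hv : IsMaxConsistent neg and D v) : IsTheory neg and fun ψ => v (box ψ) where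
  taut h := hv.of_mem (hbox.nec (hD.taut h))
  mp {φ ψ} h hφ := (hv.imp_iff _ _).1 ((hv.imp_iff _ _).1 (hv.of_mem (hbox.axK φ ψ)) h) hφ

end IsTheory

theorem IsMaxConsistent.normal_iff (hv : IsMaxConsistent neg and D v) (hD : IsTheory neg and D)
    (hbox : IsNormal neg and D box) :
    v (box φ) ↔ ∀ w, IsMaxConsistent neg and D w → (∀ ψ, v (box ψ) → w ψ) → w φ := by
  refine ⟨fun h w _ hw => hw φ h, fun h => ?_⟩
  refine (hD.preimage_normal hbox hv).mem_of_forall_isMaxConsistent fun w hw => ?_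
  exact h w ⟨hw.1, fun hψ => hw.of_mem (hv.of_mem (hbox.nec hψ))⟩ fun ψ => hw.of_mem

theorem foldr_and_iff {top : F} (hand : ∀ φ ψ, v (and φ ψ) ↔ v φ ∧ v ψ) (htop : v top)
    (l : List F) : v (l.foldr and top) ↔ ∀ φ ∈ l, v φ := by
  induction l with
  | nil => simp [htop]
  | cons φ l ih => simp [hand, ih]

theorem foldr_or_iff {or : F → F → F} {bot : F} (hor : ∀ φ ψ, v (or φ ψ) ↔ v φ ∨ v ψ)
    (hbot : ¬ v bot) (l : List F) : v (l.foldr or bot) ↔ ∃ φ ∈ l, v φ := by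
  induction l with
  | nil => simp [hbot]
  | cons φ l ih => simp [hor, ih]

end Theories

/-! ## Kripke semantics and completeness of S5 -/

/-- S5 Kripke models. The worlds live in the universe of the formulae, which is large enough for
the canonical model. -/
structure Model (P : Type u) (A : Type v) : Type (max u v + 1) where
  W : Type (max u v)
  R : A → W → W → Prop
  equiv : ∀ a, Equivalence (R a)
  V : P → W → Prop

namespace ModalForm

variable {P : Type u} {A : Type v} {φ ψ : ModalForm P A} {K : Model P A} {s : K.W} {a : A}

/-- Satisfaction of a modal formula at a world of a Kripke model. -/
def Sat : ModalForm P A → (K : Model P A) → K.W → Prop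
  | atom p, K, s => K.V p s
  | neg φ, K, s => ¬ φ.Sat K s
  | and φ ψ, K, s => φ.Sat K s ∧ ψ.Sat K s
  | box a φ, K, s => ∀ s', K.R a s s' → φ.Sat K s'

theorem isValuation_sat (K : Model P A) (s : K.W) : IsValuation neg and fun φ => φ.Sat K s :=
  ⟨fun _ => Iff.rfl, fun _ _ => Iff.rfl⟩

theorem sat_imp : (imp φ ψ).Sat K s ↔ (φ.Sat K s → ψ.Sat K s) :=
  (isValuation_sat K s).imp_iff φ ψ

theorem ProvesS5.sound (h : ProvesS5 φ) (K : Model P A) (s : K.W) : φ.Sat K s := by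
  induction h generalizing s with
  | taut h => exact h (fun ψ => ψ.Sat K s) (fun _ => Iff.rfl) (fun _ _ => Iff.rfl)
  | axK a φ ψ =>
    simp only [sat_imp, Sat]
    exact fun hφψ hφ s' r => hφψ s' r (hφ s' r)
  | axT a φ =>
    simp only [sat_imp, Sat]
    exact fun h => h s ((K.equiv a).refl s)
  | ax4 a φ =>
    simp only [sat_imp, Sat]
    exact fun h s' r s'' r' => h s'' ((K.equiv a).trans r r')
  | ax5 a φ =>
    simp only [sat_imp, Sat]
    exact fun h s' r h' => h fun s'' r' => h' s'' ((K.equiv a).trans ((K.equiv a).symm r) r')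
  | mp _ _ hφψ hφ => exact sat_imp.1 (hφψ s) (hφ s)
  | nec a _ h => exact fun s' _ => h s'

theorem isTheory_provesS5 : IsTheory neg and (ProvesS5 (P := P) (A := A)) where
  taut h := .taut fun v hneg hand => h v ⟨hneg, hand⟩
  mp := .mp

theorem isNormal_box (a : A) : IsNormal neg and (ProvesS5 (P := P)) (box a) where
  axK := .axK a
  nec := .nec a

/-- The canonical model of S5. Accessibility is equality of the sets of known formulae, which makes
it an equivalence relation by construction; `canonical_rel_iff` gives the usual description. -/
def canonical (P : Type u) (A : Type v) : Model P A where
  W := {v : ModalForm P A → Prop // IsMaxConsistent neg and ProvesS5 v}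
  R a v w := ∀ φ, v.1 (box a φ) ↔ w.1 (box a φ)
  equiv _ := ⟨fun _ _ => Iff.rfl, fun h φ => (h φ).symm, fun h h' φ => (h φ).trans (h' φ)⟩
  V p v := v.1 (atom p)

theorem canonical_rel_iff {v w : (canonical P A).W} :
    (canonical P A).R a v w ↔ ∀ φ, v.1 (box a φ) → w.1 φ := by
  have mp {v : (canonical P A).W} {χ χ' : ModalForm P A} (h : ProvesS5 (χ.imp χ')) :
      v.1 χ → v.1 χ' := (v.2.imp_iff χ χ').1 (v.2.of_mem h)
  constructor
  · exact fun r φ hφ => mp (.axT a φ) ((r φ).1 hφ)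
  · intro h φ
    refine ⟨fun hφ => h _ (mp (.ax4 a φ) hφ), fun hw => ?_⟩
    by_contra hv
    exact (w.2.neg_iff _).1 (h _ (mp (.ax5 a φ) ((v.2.neg_iff _).2 hv))) hw

theorem sat_canonical (φ : ModalForm P A) (v : (canonical P A).W) :
    φ.Sat (canonical P A) v ↔ v.1 φ := by
  induction φ generalizing v with
  | atom p => exact Iff.rfl
  | neg φ ih => rw [Sat, ih, v.2.neg_iff]
  | and φ ψ ihφ ihψ => rw [Sat, ihφ, ihψ, v.2.and_iff]
  | box a φ ih =>
    rw [v.2.normal_iff isTheory_provesS5 (isNormal_box a), Sat]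
    simp only [ih, canonical_rel_iff]
    exact ⟨fun h w hw => h ⟨w, hw⟩, fun h w => h w.1 w.2⟩

theorem ProvesS5.complete (h : ∀ (K : Model P A) s, φ.Sat K s) : ProvesS5 φ :=
  isTheory_provesS5.mem_of_forall_isMaxConsistent fun v hv =>
    (sat_canonical φ ⟨v, hv⟩).1 (h _ _)

theorem provesS5_iff : ProvesS5 φ ↔ ∀ (K : Model P A) s, φ.Sat K s :=
  ⟨ProvesS5.sound, ProvesS5.complete⟩

end ModalForm

/-! ## Finite conjunctions, disjunctions and covers -/

namespace ModalForm

variable {P : Type u} {A : Type v} {φ ψ : ModalForm P A} {K : Model P A} {s : K.W} {a : A}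

/-- Disjunction of modal formulae, as the usual abbreviation. -/
def or (φ ψ : ModalForm P A) : ModalForm P A := neg (and (neg φ) (neg ψ))

/-- The dual of the box modality. -/
def dia (a : A) (φ : ModalForm P A) : ModalForm P A := neg (box a (neg φ))

theorem sat_or : (or φ ψ).Sat K s ↔ φ.Sat K s ∨ ψ.Sat K s := by
  simp only [or, Sat, not_and_or, not_not]

theorem sat_dia : (dia a φ).Sat K s ↔ ∃ s', K.R a s s' ∧ φ.Sat K s' := by
  simp only [dia, Sat, not_forall, not_not, exists_prop]

variable [Nonempty P]

/-- The true modal formula, built from an arbitrary atom in the same way as `Form.top`. -/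
noncomputable def top : ModalForm P A :=
  or (atom (Classical.arbitrary P)) (neg (atom (Classical.arbitrary P)))

/-- The false modal formula. -/
noncomputable def bot : ModalForm P A := neg top

/-- The conjunction of the modal formulae `f i` for `i` in a finite set. -/
noncomputable def bigAnd {ι : Type*} (I : Finset ι) (f : ι → ModalForm P A) : ModalForm P A :=
  (I.toList.map f).foldr and top

/-- The disjunction of the modal formulae `f i` for `i` in a finite set. -/
noncomputable def bigOr {ι : Type*} (I : Finset ι) (f : ι → ModalForm P A) : ModalForm P A :=
  (I.toList.map f).foldr or bot

/-- The cover operator `∇_a Γ` as an operation on modal formulae. -/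
noncomputable def cover (a : A) (Γ : Finset (ModalForm P A)) : ModalForm P A :=
  and (box a (bigOr Γ id)) (bigAnd Γ (dia a))

variable {ι : Type*} {I : Finset ι} {f : ι → ModalForm P A} {Γ : Finset (ModalForm P A)}

theorem sat_top : (top : ModalForm P A).Sat K s :=
  sat_or.2 (Classical.em _)

theorem sat_bigAnd : (bigAnd I f).Sat K s ↔ ∀ i ∈ I, (f i).Sat K s := by
  rw [bigAnd, foldr_and_iff (v := fun φ : ModalForm P A => φ.Sat K s) (fun _ _ => Iff.rfl) sat_top]
  simp only [List.forall_mem_map, Finset.mem_toList]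

theorem sat_bigOr : (bigOr I f).Sat K s ↔ ∃ i ∈ I, (f i).Sat K s := by
  have hbot : ¬ (bot : ModalForm P A).Sat K s := not_not_intro sat_top
  rw [bigOr, foldr_or_iff (v := fun φ : ModalForm P A => φ.Sat K s) (fun _ _ => sat_or) hbot]
  simp only [List.mem_map, exists_exists_and_eq_and, Finset.mem_toList]

theorem sat_cover : (cover a Γ).Sat K s ↔ (∀ s', K.R a s s' → ∃ γ ∈ Γ, γ.Sat K s') ∧
    ∀ γ ∈ Γ, ∃ s', K.R a s s' ∧ γ.Sat K s' := by
  simp only [cover, Sat, sat_bigAnd, sat_bigOr, sat_dia, id]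

end ModalForm

namespace Form

variable {P : Type u} {A : Type v} [Nonempty P]

theorem ofModal_bigAnd {ι : Type*} (I : Finset ι) (f : ι → ModalForm P A) :
    ofModal (.bigAnd I f) = bigAnd I fun i => ofModal (f i) := by
  rw [ModalForm.bigAnd, bigAnd]
  induction I.toList with
  | nil => rfl
  | cons i l ih => exact congrArg _ ih

theorem ofModal_bigOr {ι : Type*} (I : Finset ι) (f : ι → ModalForm P A) :
    ofModal (.bigOr I f) = bigOr I fun i => ofModal (f i) := by
  rw [ModalForm.bigOr, bigOr]
  induction I.toList with
  | nil => rfl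
  | cons i l ih => exact congrArg (or _) ih

theorem ofModal_cover (a : A) (Γ : Finset (ModalForm P A)) :
    ofModal (.cover a Γ) = cover a Γ := by
  simp only [ModalForm.cover, cover, ofModal, ofModal_bigAnd, ofModal_bigOr, ModalForm.dia, dia, id]

end Form

/-! ## Action models: semantics and reduction to modal formulae -/

instance (F : ActFrame A) : Finite F.pt := F.finite

/-- The product update of a Kripke model with an action frame: `pre t` is the set of the worlds at
which the action `t` can be executed. -/
def Model.upd {P : Type u} {A : Type v} (K : Model P A) (F : ActFrame A)
    (pre : F.pt → K.W → Prop) : Model P A where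
  W := {x : K.W × F.pt // pre x.2 x.1}
  R a x y := K.R a x.1.1 y.1.1 ∧ F.rel a x.1.2 y.1.2
  equiv a :=
    ⟨fun x => ⟨(K.equiv a).refl x.1.1, (F.equiv a).refl x.1.2⟩,
     fun h => ⟨(K.equiv a).symm h.1, (F.equiv a).symm h.2⟩,
     fun h k => ⟨(K.equiv a).trans h.1 k.1, (F.equiv a).trans h.2 k.2⟩⟩
  V p x := K.V p x.1.1

namespace ModalForm

variable {P : Type u} {A : Type v} [Nonempty P]

/-- The modal formula that says that `φ` holds after the action `t` of a frame `F` with modal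
preconditions `pre`, if `t` can be executed. -/
noncomputable def regress (F : ActFrame A) (pre : F.pt → ModalForm P A) :
    F.pt → ModalForm P A → ModalForm P A
  | t, atom p => (pre t).imp (atom p)
  | t, neg φ => (pre t).imp (neg (regress F pre t φ))
  | t, and φ ψ => and (regress F pre t φ) (regress F pre t ψ)
  | t, box a φ => (pre t).imp
      (box a (bigAnd (Set.toFinite {u | F.rel a t u}).toFinset fun u => regress F pre u φ))

theorem sat_regress {F : ActFrame A} {pre : F.pt → ModalForm P A} {K : Model P A}
    {pr : F.pt → K.W → Prop} (hpr : ∀ t s, (pre t).Sat K s ↔ pr t s) {t : F.pt} {s : K.W}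
    {φ : ModalForm P A} : (regress F pre t φ).Sat K s ↔
      ∀ h : pr t s, φ.Sat (K.upd F pr) ⟨(s, t), h⟩ := by
  induction φ generalizing t s with
  | atom p => simp only [regress, sat_imp, hpr, Sat, Model.upd]
  | neg φ ih =>
    simp only [regress, sat_imp, hpr, Sat, ih]
    exact forall_congr' fun h => not_congr ⟨fun k => k h, fun k _ => k⟩
  | and φ ψ ihφ ihψ => simp only [regress, Sat, ihφ, ihψ, forall_and]
  | box a φ ih =>
    simp only [regress, sat_imp, hpr, Sat, sat_bigAnd, ih, Set.Finite.mem_toFinset]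
    exact forall_congr' fun _ => ⟨fun k x hx => k x.1.1 hx.1 x.1.2 hx.2 x.2,
      fun k s' r u hu h => k ⟨(s', u), h⟩ ⟨r, hu⟩⟩

end ModalForm

namespace Form

variable {P : Type u} {A : Type v}

/-- Satisfaction of a formula without refinement quantifiers at a world of a Kripke model. In other
formulae the refinement quantifiers are ignored. -/
def Sat : Form P A → (K : Model P A) → K.W → Prop
  | atom p, K, s => K.V p s
  | neg φ, K, s => ¬ φ.Sat K s
  | and φ ψ, K, s => φ.Sat K s ∧ ψ.Sat K s
  | box a φ, K, s => ∀ s', K.R a s s' → φ.Sat K s'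
  | act F pre T φ, K, s => ∀ t ∈ T, ∀ h : (pre t).Sat K s,
      φ.Sat (K.upd F fun t s => (pre t).Sat K s) ⟨(s, t), h⟩
  | allRef φ, K, s => φ.Sat K s

end Form

/-- The result of executing an action model on a Kripke model. -/
def ActModel.exec {P : Type u} {A : Type v} (M : ActModel P A) (K : Model P A) : Model P A :=
  K.upd M.frame fun t s => (M.pre t).Sat K s

namespace Form

section Semantics

variable {P : Type u} {A : Type v} {φ ψ : Form P A} {m : ModalForm P A} {M : ActModel P A}
  {t : M.frame.pt} {K : Model P A} {s : K.W}

theorem sat_imp : (imp φ ψ).Sat K s ↔ (φ.Sat K s → ψ.Sat K s) := by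
  simp only [imp, Sat, not_and, not_not]

theorem sat_top [Nonempty P] : (top : Form P A).Sat K s := by
  simp only [top, or, Sat, not_not, not_and_self_iff, not_false_eq_true]

theorem sat_ofModal : (ofModal m).Sat K s ↔ m.Sat K s := by
  induction m generalizing s with
  | atom p => rfl
  | neg φ ih => exact not_congr ih
  | and φ ψ ihφ ihψ => exact and_congr ihφ ihψ
  | box a φ ih => exact forall₂_congr fun _ _ => ih

theorem sat_someAct : (someAct M φ).Sat K s ↔
    ∃ t ∈ M.pts, ∃ h : (M.pre t).Sat K s, φ.Sat (M.exec K) ⟨(s, t), h⟩ := by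
  simp only [someAct, allAct, Sat, not_forall, not_not, exists_prop, ActModel.exec]

theorem sat_someAct_pt : (someAct (M.withPts {t}) φ).Sat K s ↔
    ∃ h : (M.pre t).Sat K s, φ.Sat (M.exec K) ⟨(s, t), h⟩ := by
  refine sat_someAct.trans ⟨?_, fun h => ⟨t, rfl, h⟩⟩
  rintro ⟨(t' : M.frame.pt), (rfl : t' = t), h⟩
  exact h

/-- The modal formula that results from a formula without refinement quantifiers by eliminating the
action models. In other formulae the refinement quantifiers are ignored. -/
noncomputable def reduce [Nonempty P] : Form P A → ModalForm P A
  | atom p => .atom p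
  | neg φ => .neg φ.reduce
  | and φ ψ => .and φ.reduce ψ.reduce
  | box a φ => .box a φ.reduce
  | act F pre T φ => .bigAnd (Set.toFinite T).toFinset fun t =>
      .regress F (fun t => (pre t).reduce) t φ.reduce
  | allRef φ => φ.reduce

theorem sat_reduce [Nonempty P] : φ.reduce.Sat K s ↔ φ.Sat K s := by
  induction φ generalizing K with
  | atom p => rfl
  | neg φ ih => exact not_congr ih
  | and φ ψ ihφ ihψ => exact and_congr ihφ ihψ
  | box a φ ih => exact forall₂_congr fun _ _ => ih
  | act F pre T φ ihpre ih =>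
    simp only [reduce, Sat, ModalForm.sat_bigAnd, Set.Finite.mem_toFinset,
      ModalForm.sat_regress fun _ _ => ihpre _]
    exact forall₂_congr fun _ _ => forall_congr' fun _ => ih
  | allRef _ ih => exact ih

/-- The formulae without refinement quantifiers. -/
def RefFree : Form P A → Prop
  | atom _ => True
  | neg φ => φ.RefFree
  | and φ ψ => φ.RefFree ∧ ψ.RefFree
  | box _ φ => φ.RefFree
  | act _ pre _ φ => (∀ t, (pre t).RefFree) ∧ φ.RefFree
  | allRef _ => False

theorem refFree_ofModal (m : ModalForm P A) : (ofModal m).RefFree := by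
  induction m with
  | atom _ => trivial
  | neg _ ih => exact ih
  | and φ ψ ihφ ihψ => exact ⟨ihφ, ihψ⟩
  | box _ _ ih => exact ih

end Semantics

/-! ## Maximal consistent sets of arbitrary action model logic -/

section MaximalConsistent

variable {P : Type u} {A : Type v} [Nonempty P] [Fintype A]

/-- Maximal consistent sets of formulae of arbitrary action model logic. -/
abbrev IsMCS (v : Form P A → Prop) : Prop := IsMaxConsistent neg and Provable v

theorem isTheory_provable : IsTheory neg and (Provable (P := P) (A := A)) where
  taut h := .taut fun v hneg hand => h v ⟨hneg, hand⟩
  mp := .mp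

theorem isNormal_box (a : A) : IsNormal neg and (Provable (P := P)) (box a) where
  axK := .axK a
  nec := .nec a

theorem isNormal_allRef : IsNormal neg and (Provable (P := P) (A := A)) allRef where
  axK := .axR
  nec := .necR

theorem provable_of_forall_isMCS {φ : Form P A} (h : ∀ v, IsMCS v → v φ) : Provable φ :=
  isTheory_provable.mem_of_forall_isMaxConsistent h

namespace IsMCS

variable {v : Form P A → Prop} {φ ψ : Form P A} {a : A} {ι : Type*} {I : Finset ι}
  {f : ι → Form P A} {m n : ModalForm P A}

theorem imp_iff (hv : IsMCS v) : v (imp φ ψ) ↔ (v φ → v ψ) :=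
  IsValuation.imp_iff hv.1 φ ψ

theorem iff_iff (hv : IsMCS v) : v (iff φ ψ) ↔ (v φ ↔ v ψ) := by
  rw [iff, hv.and_iff, hv.imp_iff, hv.imp_iff]
  exact iff_def.symm

theorem top_mem (hv : IsMCS v) : v top :=
  hv.of_mem (.taut fun w hneg hand => by
    simp only [top, or, hneg, hand, not_not, not_and_self_iff, not_false_eq_true])

theorem bigAnd_iff (hv : IsMCS v) : v (bigAnd I f) ↔ ∀ i ∈ I, v (f i) := by
  rw [bigAnd, foldr_and_iff hv.and_iff hv.top_mem]
  simp only [List.forall_mem_map, Finset.mem_toList]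

theorem bigOr_iff (hv : IsMCS v) : v (bigOr I f) ↔ ∃ i ∈ I, v (f i) := by
  have hor (φ ψ) : v (or φ ψ) ↔ v φ ∨ v ψ := by
    rw [or, hv.neg_iff, hv.and_iff, hv.neg_iff, hv.neg_iff, ← not_or, not_not]
  have hbot : ¬ v bot := (hv.neg_iff _).not_left.2 hv.top_mem
  rw [bigOr, foldr_or_iff hor hbot]
  simp only [List.mem_map, exists_exists_and_eq_and, Finset.mem_toList]

theorem iff_of_provable (hv : IsMCS v) (h : Provable (iff φ ψ)) : v φ ↔ v ψ :=
  hv.iff_iff.1 (hv.of_mem h)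

theorem box_mono (hv : IsMCS v) (h : ∀ w, IsMCS w → w φ → w ψ) (hφ : v (box a φ)) :
    v (box a ψ) := by
  rw [hv.normal_iff isTheory_provable (isNormal_box a)] at hφ ⊢
  exact fun w hw k => h w hw (hφ w hw k)

theorem box_congr (hv : IsMCS v) (h : ∀ w, IsMCS w → (w φ ↔ w ψ)) :
    v (box a φ) ↔ v (box a ψ) :=
  ⟨hv.box_mono fun w hw => (h w hw).1, hv.box_mono fun w hw => (h w hw).2⟩

theorem dia_mono (hv : IsMCS v) (h : ∀ w, IsMCS w → w φ → w ψ) : v (dia a φ) → v (dia a ψ) := by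
  rw [dia, dia, hv.neg_iff, hv.neg_iff, not_imp_not]
  refine hv.box_mono fun w hw => ?_
  rw [hw.neg_iff, hw.neg_iff, not_imp_not]
  exact h w hw

theorem someRef_iff (hv : IsMCS v) :
    v (someRef φ) ↔ ∃ w, IsMCS w ∧ (∀ ψ, v (allRef ψ) → w ψ) ∧ w φ := by
  rw [someRef, hv.neg_iff, hv.normal_iff isTheory_provable isNormal_allRef]
  push Not
  refine exists_congr fun w => and_congr_right fun hw => ?_
  rw [hw.neg_iff, not_not]

theorem provesS5_ofModal (hv : IsMCS v) (h : m.ProvesS5) : v (ofModal m) := by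
  refine hv.of_mem ?_
  induction h with
  | taut h =>
    exact .taut fun w hneg hand =>
      h (fun φ => w (ofModal φ)) (fun _ => hneg _) (fun _ _ => hand _ _)
  | axK a φ ψ => exact .axK a _ _
  | axT a φ => exact .axT a _
  | ax4 a φ => exact .ax4 a _
  | ax5 a φ => exact .ax5 a _
  | mp _ _ hmn hm => exact .mp hmn hm
  | nec a _ h => exact .nec a h

variable {M N : ActModel P A} {t : M.frame.pt}

theorem allAct_iff (hv : IsMCS v) :
    v (allAct M φ) ↔ ∀ t ∈ M.pts, v (allAct (M.withPts {t}) φ) := by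
  simp only [hv.iff_of_provable (.axAU M φ), hv.bigAnd_iff, ActModel.ptsFinset,
    Set.Finite.mem_toFinset]

theorem allAct_atom (hv : IsMCS v) {p : P} :
    v (allAct (M.withPts {t}) (atom p)) ↔ (v (M.pre t) → v (atom p)) := by
  rw [hv.iff_of_provable (.axAP M t p), hv.imp_iff]

theorem allAct_neg (hv : IsMCS v) : v (allAct (M.withPts {t}) (neg φ)) ↔
    (v (M.pre t) → ¬ v (allAct (M.withPts {t}) φ)) := by
  rw [hv.iff_of_provable (.axAN M t φ), hv.imp_iff, hv.neg_iff]

theorem allAct_and (hv : IsMCS v) : v (allAct (M.withPts {t}) (and φ ψ)) ↔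
    v (allAct (M.withPts {t}) φ) ∧ v (allAct (M.withPts {t}) ψ) := by
  rw [hv.iff_of_provable (.axAC M t φ ψ), hv.and_iff]

theorem allAct_box (hv : IsMCS v) : v (allAct (M.withPts {t}) (box a φ)) ↔
    (v (M.pre t) → v (box a (allAct (M.withPts {u | M.frame.rel a t u}) φ))) := by
  rw [hv.iff_of_provable (.axAK M t a φ), hv.imp_iff]

theorem allAct_of_not_pre (hv : IsMCS v) (hφ : φ.RefFree) (h : ¬ v (M.pre t)) :
    v (allAct (M.withPts {t}) φ) := by
  induction φ generalizing M with
  | atom p => exact hv.allAct_atom.2 fun k => absurd k h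
  | neg φ => exact hv.allAct_neg.2 fun k => absurd k h
  | and φ ψ ihφ ihψ => exact hv.allAct_and.2 ⟨ihφ hφ.1 h, ihψ hφ.2 h⟩
  | box a φ => exact hv.allAct_box.2 fun k => absurd k h
  | act F pre T φ _ ih =>
    -- `[M_t][N]φ` amounts to `[M_t ⊗ N]φ`, and no action of `M_t ⊗ N` can be executed either.
    refine (hv.iff_of_provable (.axAS (M.withPts {t}) ⟨F, pre, T⟩ φ)).1 (hv.allAct_iff.2 ?_)
    rintro ⟨(t' : M.frame.pt), y⟩ ⟨(rfl : t' = t), -⟩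
    refine ih hφ.2 ?_
    change ¬ v (neg (allAct (M.withPts {t'}) (neg (pre y))))
    rw [hv.neg_iff, not_not]
    exact hv.allAct_neg.2 fun k => absurd k h
  | allRef φ => exact hφ.elim

theorem isMCS_allAct (hv : IsMCS v) (h : v (M.pre t)) :
    IsMCS fun φ => v (allAct (M.withPts {t}) φ) where
  neg_iff _ := hv.allAct_neg.trans ⟨fun k => k h, fun k _ => k⟩
  and_iff _ _ := hv.allAct_and
  of_mem hφ := hv.of_mem (.necA _ hφ)

theorem allAct_congr (hv : IsMCS v) (hφ : φ.RefFree) (hψ : ψ.RefFree)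
    (h : ∀ w, IsMCS w → (w φ ↔ w ψ)) :
    v (allAct (M.withPts {t}) φ) ↔ v (allAct (M.withPts {t}) ψ) := by
  by_cases ht : v (M.pre t)
  · exact h _ (hv.isMCS_allAct ht)
  · exact iff_of_true (hv.allAct_of_not_pre hφ ht) (hv.allAct_of_not_pre hψ ht)

theorem allAct_ofModal_iff (hv : IsMCS v) {pre : M.frame.pt → ModalForm P A}
    (hpre : ∀ w, IsMCS w → ∀ t, (w (M.pre t) ↔ w (ofModal (pre t)))) :
    v (allAct (M.withPts {t}) (ofModal m)) ↔ v (ofModal (.regress M.frame pre t m)) := by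
  have ofModal_imp (n k : ModalForm P A) : ofModal (n.imp k) = imp (ofModal n) (ofModal k) := rfl
  induction m generalizing v t with
  | atom p => simp only [ofModal, hv.allAct_atom, ModalForm.regress, ofModal_imp, hv.imp_iff,
      hpre v hv]
  | neg m ih => simp only [ofModal, hv.allAct_neg, ModalForm.regress, ofModal_imp, hv.imp_iff,
      hpre v hv, hv.neg_iff, ih hv]
  | and m n ihm ihn => simp only [ofModal, hv.allAct_and, ModalForm.regress, hv.and_iff, ihm hv,
      ihn hv]
  | box a m ih =>
    simp only [ofModal, hv.allAct_box, ModalForm.regress, ofModal_imp, hv.imp_iff, hpre v hv,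
      ofModal_bigAnd]
    refine imp_congr_right fun _ => hv.box_congr fun w hw => ?_
    rw [hw.allAct_iff, hw.bigAnd_iff]
    simp only [Set.Finite.mem_toFinset]
    exact forall₂_congr fun u _ => ih hw

theorem iff_reduce (hv : IsMCS v) (hφ : φ.RefFree) : v φ ↔ v (ofModal φ.reduce) := by
  induction φ generalizing v with
  | atom p => rfl
  | neg φ ih => simp only [reduce, ofModal, hv.neg_iff, ih hv hφ]
  | and φ ψ ihφ ihψ => simp only [reduce, ofModal, hv.and_iff, ihφ hv hφ.1, ihψ hv hφ.2]
  | box a φ ih => exact hv.box_congr fun w hw => ih hw hφ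
  | act F pre T φ ihpre ih =>
    let M : ActModel P A := ⟨F, pre, T⟩
    simp only [reduce, ofModal_bigAnd, hv.bigAnd_iff, Set.Finite.mem_toFinset]
    refine (hv.allAct_iff (M := M)).trans (forall₂_congr fun t _ => ?_)
    rw [hv.allAct_congr hφ.2 (refFree_ofModal _) fun w hw => ih hw hφ.2]
    exact hv.allAct_ofModal_iff fun w hw t => ihpre t hw (hφ.1 t)
  | allRef φ => exact hφ.elim

theorem of_forall_sat (hv : IsMCS v) (hφ : φ.RefFree) (h : ∀ K s, φ.Sat K s) : v φ :=
  (hv.iff_reduce hφ).2 (hv.provesS5_ofModal (.complete fun K s => sat_reduce.2 (h K s)))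

theorem imp_of_sat (hv : IsMCS v) (hφ : φ.RefFree) (hψ : ψ.RefFree)
    (h : ∀ K s, φ.Sat K s → ψ.Sat K s) : v φ → v ψ :=
  hv.imp_iff.1 (hv.of_forall_sat (φ := imp φ ψ) ⟨hφ, hψ⟩ fun K s => sat_imp.2 (h K s))

end IsMCS

end MaximalConsistent

end Form

/-! ## Types of bounded modal depth and their characteristic formulae -/

/-- The types of modal depth at most `k` over the atoms in `Q`: a type of depth `0` is a set of
atoms, and a type of depth `k + 1` consists of a type of depth `k` and, for each agent, a set of
types of depth `k`. -/
def Ty {P : Type u} (Q : Finset P) (A : Type v) : ℕ → Type (max u v)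
  | 0 => ULift.{v} (Set Q)
  | k + 1 => Ty Q A k × (A → Set (Ty Q A k))

instance {P : Type u} {Q : Finset P} {A : Type v} [Finite A] (k : ℕ) : Finite (Ty Q A k) := by
  induction k with
  | zero => exact inferInstanceAs (Finite (ULift.{v} (Set Q)))
  | succ k ih => exact inferInstanceAs (Finite (Ty Q A k × (A → Set (Ty Q A k))))

namespace Model

variable {P : Type u} {A : Type v} {Q : Finset P} {K K' : Model P A} {k l : ℕ} {a : A}

/-- The type of a world: which atoms in `Q` are true at it and, up to the given depth, which types
the agents consider possible. -/
def ty (Q : Finset P) (K : Model P A) : (k : ℕ) → K.W → Ty Q A k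
  | 0, s => ⟨{q | K.V q s}⟩
  | k + 1, s => (K.ty Q k s, fun a => {σ | ∃ s', K.R a s s' ∧ K.ty Q k s' = σ})

theorem mem_ty_succ {s : K.W} {σ : Ty Q A k} :
    σ ∈ (K.ty Q (k + 1) s).2 a ↔ ∃ s', K.R a s s' ∧ K.ty Q k s' = σ := Iff.rfl

theorem ty_eq_of_le (h : k ≤ l) {s : K.W} {s' : K'.W} (e : K.ty Q l s = K'.ty Q l s') :
    K.ty Q k s = K'.ty Q k s' := by
  induction h with
  | refl => exact e
  | step _ ih => exact ih (congrArg Prod.fst e)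

theorem ty_succ_snd_eq (k : ℕ) {s s' : K.W} (h : K.R a s s') :
    (K.ty Q (k + 1) s).2 a = (K.ty Q (k + 1) s').2 a :=
  Set.ext fun _ => exists_congr fun _ => and_congr_left fun _ =>
    ⟨(K.equiv a).trans ((K.equiv a).symm h), (K.equiv a).trans h⟩

end Model

namespace ModalForm

variable {P : Type u} {A : Type v} {Q Q' : Finset P} {φ ψ : ModalForm P A} {k l : ℕ}

/-- The formulae of modal depth at most `k` over the atoms in `Q`. -/
def IsBounded (Q : Finset P) : ModalForm P A → ℕ → Prop
  | atom p, _ => p ∈ Q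
  | neg φ, k => φ.IsBounded Q k
  | and φ ψ, k => φ.IsBounded Q k ∧ ψ.IsBounded Q k
  | box _ _, 0 => False
  | box _ φ, k + 1 => φ.IsBounded Q k

theorem IsBounded.mono (h : φ.IsBounded Q k) (hQ : Q ⊆ Q') (hk : k ≤ l) : φ.IsBounded Q' l := by
  induction φ generalizing k l with
  | atom p => exact hQ h
  | neg φ ih => exact ih h hk
  | and φ ψ ihφ ihψ => exact ⟨ihφ h.1 hk, ihψ h.2 hk⟩
  | box a φ ih =>
    obtain _ | k := k
    · exact h.elim
    · obtain ⟨l, rfl⟩ := Nat.exists_eq_add_of_le' hk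
      exact ih (k := k) h (Nat.le_add_left k l)

theorem exists_isBounded (φ : ModalForm P A) : ∃ Q k, φ.IsBounded Q k := by
  classical
  induction φ with
  | atom p => exact ⟨{p}, 0, Finset.mem_singleton_self p⟩
  | neg _ ih => exact ih
  | and φ ψ ihφ ihψ =>
    obtain ⟨Q, k, hφ⟩ := ihφ
    obtain ⟨Q', k', hψ⟩ := ihψ
    exact ⟨Q ∪ Q', max k k', hφ.mono Finset.subset_union_left (le_max_left _ _),
      hψ.mono Finset.subset_union_right (le_max_right _ _)⟩
  | box a φ ih =>
    obtain ⟨Q, k, hφ⟩ := ih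
    exact ⟨Q, k + 1, hφ⟩

theorem mem_subs_self (φ : ModalForm P A) : φ ∈ φ.subs := by
  cases φ
  exacts [rfl, Set.mem_insert _ _, Set.mem_insert _ _, Set.mem_insert _ _]

theorem IsBounded.of_mem_subs (h : φ.IsBounded Q k) (hψ : ψ ∈ φ.subs) : ψ.IsBounded Q k := by
  induction φ generalizing k with
  | atom p =>
    obtain rfl := hψ
    exact h
  | neg φ ih =>
    obtain rfl | hψ := hψ
    exacts [h, ih h hψ]
  | and φ χ ihφ ihχ =>
    obtain rfl | hψ | hψ := hψ
    exacts [h, ihφ h.1 hψ, ihχ h.2 hψ]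
  | box a φ ih =>
    obtain rfl | hψ := hψ
    · exact h
    · obtain _ | k := k
      · exact h.elim
      · exact (ih (k := k) h hψ).mono subset_rfl (Nat.le_succ k)

theorem IsBounded.sat_iff (h : φ.IsBounded Q k) {K K' : Model P A} {s : K.W} {s' : K'.W}
    (e : K.ty Q k s = K'.ty Q k s') : φ.Sat K s ↔ φ.Sat K' s' := by
  induction φ generalizing k s s' with
  | atom p =>
    have e₀ : K.ty Q 0 s = K'.ty Q 0 s' := Model.ty_eq_of_le (Nat.zero_le k) e
    exact iff_of_eq (congrArg (fun τ : Ty Q A 0 => (⟨p, h⟩ : Q) ∈ τ.down) e₀)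
  | neg φ ih => exact not_congr (ih h e)
  | and φ ψ ihφ ihψ => exact and_congr (ihφ h.1 e) (ihψ h.2 e)
  | box a φ ih =>
    obtain _ | k := k
    · exact h.elim
    have e' : (K.ty Q (k + 1) s).2 a = (K'.ty Q (k + 1) s').2 a := by rw [e]
    constructor
    · intro hs t r
      obtain ⟨t', r', et⟩ : K'.ty Q k t ∈ (K.ty Q (k + 1) s).2 a := e' ▸ ⟨t, r, rfl⟩
      exact (ih (k := k) h et).1 (hs t' r')
    · intro hs t r
      obtain ⟨t', r', et⟩ : K.ty Q k t ∈ (K'.ty Q (k + 1) s').2 a := e' ▸ ⟨t, r, rfl⟩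
      exact (ih (k := k) h et.symm).2 (hs t' r')

theorem Explicit.mono {B B' : Set A} {γ₀ : ModalForm P A} {Γ : A → Finset (ModalForm P A)}
    (h : Explicit B γ₀ Γ) (hB : B' ⊆ B) : Explicit B' γ₀ Γ := by
  obtain ⟨hγ₀, hdecides, hbox⟩ := h
  refine ⟨fun a ha => hγ₀ a (hB ha), ?_, ?_⟩
  · rintro a ha γ hγ ψ ⟨b, hb, hψ⟩
    exact hdecides a (hB ha) γ hγ ψ ⟨b, hB hb, hψ⟩
  · rintro a ha γ hγ ψ ⟨b, hb, hψ⟩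
    exact hbox a (hB ha) γ hγ ψ ⟨b, hB hb, hψ⟩

section BigOperators

variable [Nonempty P] {ι : Type*} {I : Finset ι} {f : ι → ModalForm P A}

theorem isBounded_bigAnd (hQ : Classical.arbitrary P ∈ Q) (h : ∀ i ∈ I, (f i).IsBounded Q k) :
    (bigAnd I f).IsBounded Q k := by
  have htop : (top : ModalForm P A).IsBounded Q k := ⟨hQ, hQ⟩
  refine (foldr_and_iff (v := fun φ : ModalForm P A => φ.IsBounded Q k)
    (fun _ _ => Iff.rfl) htop _).2 ?_
  simpa only [List.forall_mem_map, Finset.mem_toList]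

theorem isBounded_bigOr (hQ : Classical.arbitrary P ∈ Q) (h : ∀ i ∈ I, (f i).IsBounded Q k) :
    (bigOr I f).IsBounded Q k := by
  -- A disjunction is bounded under the same condition as a conjunction.
  have hbot : (bot : ModalForm P A).IsBounded Q k := ⟨hQ, hQ⟩
  refine (foldr_and_iff (v := fun φ : ModalForm P A => φ.IsBounded Q k)
    (fun _ _ => Iff.rfl) hbot _).2 ?_
  simpa only [List.forall_mem_map, Finset.mem_toList]

theorem isBounded_cover (hQ : Classical.arbitrary P ∈ Q) {a : A} {Γ : Finset (ModalForm P A)}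
    (h : ∀ γ ∈ Γ, γ.IsBounded Q k) : (cover a Γ).IsBounded Q (k + 1) :=
  ⟨isBounded_bigOr (k := k) hQ h, isBounded_bigAnd hQ fun γ hγ => h γ hγ⟩

/-- `◇_a (f i)` for all `i` in a set. -/
noncomputable def bigDia [Finite ι] (a : A) (S : Set ι) (f : ι → ModalForm P A) : ModalForm P A :=
  bigAnd S.toFinite.toFinset fun i => dia a (f i)

theorem sat_bigDia [Finite ι] {a : A} {S : Set ι} {K : Model P A} {s : K.W} :
    (bigDia a S f).Sat K s ↔ ∀ i ∈ S, ∃ s', K.R a s s' ∧ (f i).Sat K s' := by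
  simp only [bigDia, sat_bigAnd, Set.Finite.mem_toFinset, sat_dia]

theorem sat_bigDia_congr [Finite ι] {a : A} {S : Set ι} {K : Model P A} {s s' : K.W}
    (r : K.R a s s') : (bigDia a S f).Sat K s ↔ (bigDia a S f).Sat K s' := by
  simp only [sat_bigDia]
  exact forall₂_congr fun _ _ => exists_congr fun _ => and_congr_left fun _ =>
    ⟨(K.equiv a).trans ((K.equiv a).symm r), (K.equiv a).trans r⟩

end BigOperators

end ModalForm

namespace Ty

open ModalForm

variable {P : Type u} {A : Type v} {Q : Finset P} {k : ℕ}

/-- The types of the worlds of Kripke models. -/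
def Realizable (τ : Ty Q A k) : Prop := ∃ (K : Model P A) (s : K.W), K.ty Q k s = τ

theorem Realizable.fst {τ : Ty Q A (k + 1)} (h : τ.Realizable) : Realizable τ.1 :=
  have ⟨K, s, e⟩ := h
  ⟨K, s, congrArg Prod.fst e⟩

theorem Realizable.fst_mem {τ : Ty Q A (k + 1)} (h : τ.Realizable) (a : A) : τ.1 ∈ τ.2 a := by
  obtain ⟨K, s, rfl⟩ := h
  exact ⟨s, (K.equiv a).refl s, rfl⟩

theorem Realizable.of_mem {τ : Ty Q A (k + 1)} (h : τ.Realizable) {a : A} {σ : Ty Q A k}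
    (hσ : σ ∈ τ.2 a) : σ.Realizable := by
  obtain ⟨K, s, rfl⟩ := h
  obtain ⟨s', -, e⟩ := hσ
  exact ⟨K, s', e⟩

variable [Nonempty P] [Fintype A]

open Classical in
/-- The characteristic formula of a type; it is true at the worlds of that type only. -/
noncomputable def chr : (k : ℕ) → Ty Q A k → ModalForm P A
  | 0, τ => bigAnd Finset.univ fun q : Q => if q ∈ τ.down then atom q else neg (atom q)
  | k + 1, τ => and (chr k τ.1)
      (bigAnd Finset.univ fun a => cover a ((τ.2 a).toFinite.image (chr k)).toFinset)

/-- The characteristic formulae of a set of types. -/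
noncomputable def chrs (S : Set (Ty Q A k)) : Finset (ModalForm P A) :=
  (S.toFinite.image (chr k)).toFinset

theorem forall_mem_chrs {S : Set (Ty Q A k)} {p : ModalForm P A → Prop} :
    (∀ γ ∈ chrs S, p γ) ↔ ∀ σ ∈ S, p (chr k σ) := by
  simp only [chrs, Set.Finite.mem_toFinset, Set.forall_mem_image]

theorem exists_mem_chrs {S : Set (Ty Q A k)} {p : ModalForm P A → Prop} :
    (∃ γ ∈ chrs S, p γ) ↔ ∃ σ ∈ S, p (chr k σ) := by
  simp only [chrs, Set.Finite.mem_toFinset, Set.exists_mem_image]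

theorem chr_mem_chrs {S : Set (Ty Q A k)} {σ : Ty Q A k} (h : σ ∈ S) : chr k σ ∈ chrs S :=
  (Set.Finite.mem_toFinset _).2 (Set.mem_image_of_mem _ h)

theorem chr_succ (τ : Ty Q A (k + 1)) :
    chr (k + 1) τ = and (chr k τ.1) (bigAnd Finset.univ fun a => cover a (chrs (τ.2 a))) := rfl

open Classical in
theorem sat_chr {τ : Ty Q A k} {K : Model P A} {s : K.W} :
    (chr k τ).Sat K s ↔ K.ty Q k s = τ := by
  induction k generalizing s with
  | zero =>
    have hq (q : Q) : (if q ∈ τ.down then atom (q : P) else neg (atom q)).Sat K s ↔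
        (K.V q s ↔ q ∈ τ.down) := by
      split_ifs with h <;> simp only [Sat, h, iff_true, iff_false]
    simp only [chr, sat_bigAnd, Finset.mem_univ, forall_const, hq]
    exact ⟨fun h => congrArg ULift.up (Set.ext h), fun h => by simp [← h, Model.ty]⟩
  | succ k ih =>
    have hcover (a : A) : (cover a (chrs (τ.2 a))).Sat K s ↔ (K.ty Q (k + 1) s).2 a = τ.2 a := by
      simp only [sat_cover, forall_mem_chrs, exists_mem_chrs, ih, exists_eq_right', Set.ext_iff,
        Model.mem_ty_succ]
      exact ⟨fun h σ => ⟨fun ⟨s', r, e⟩ => e ▸ h.1 s' r, h.2 σ⟩,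
        fun h => ⟨fun s' r => (h _).1 ⟨s', r, rfl⟩, fun σ => (h σ).2⟩⟩
    simp only [chr_succ, Sat, sat_bigAnd, Finset.mem_univ, forall_const, hcover, ih]
    exact ⟨fun h => Prod.ext h.1 (funext h.2), fun h => h ▸ ⟨rfl, fun _ => rfl⟩⟩

theorem isBounded_chr (hQ : Classical.arbitrary P ∈ Q) (τ : Ty Q A k) :
    (chr k τ).IsBounded Q k := by
  induction k with
  | zero =>
    refine isBounded_bigAnd hQ fun q _ => ?_
    split_ifs <;> exact q.2
  | succ k ih => exact ⟨(ih _).mono subset_rfl (Nat.le_succ k), isBounded_bigAnd hQ fun a _ =>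
      isBounded_cover hQ (forall_mem_chrs.2 fun σ _ => ih σ)⟩

theorem isProp_ofModal_chr_zero (τ : Ty Q A 0) : (Form.ofModal (chr 0 τ)).IsProp := by
  rw [chr, Form.ofModal_bigAnd]
  have htop : (Form.top : Form P A).IsProp := ⟨trivial, trivial⟩
  refine (foldr_and_iff (v := Form.IsProp) (fun _ _ => Iff.rfl) htop _).2 ?_
  rw [List.forall_mem_map]
  intro q _
  split_ifs <;> trivial

theorem provesS5_chr_ty_imp_iff {K : Model P A} {s : K.W} {ψ : ModalForm P A}
    (hψ : ψ.IsBounded Q k) : ProvesS5 ((chr k (K.ty Q k s)).imp ψ) ↔ ψ.Sat K s := by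
  simp only [provesS5_iff, sat_imp, sat_chr]
  exact ⟨fun h => h K s rfl, fun h K' s' e => (hψ.sat_iff e).2 h⟩

theorem explicit_chr (hQ : Classical.arbitrary P ∈ Q) {K : Model P A} (s : K.W) :
    Explicit Set.univ (chr k (K.ty Q k s)) fun a => chrs ((K.ty Q (k + 1) s).2 a) := by
  have isBounded_of_mem_subs : ∀ ψ : ModalForm P A,
      (∃ a ∈ Set.univ, ∃ γ ∈ chrs ((K.ty Q (k + 1) s).2 a), ψ ∈ γ.subs) → ψ.IsBounded Q k := by
    simp only [exists_mem_chrs]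
    rintro ψ ⟨a, _, σ, _, hψ⟩
    exact (isBounded_chr hQ σ).of_mem_subs hψ
  refine ⟨fun a _ => chr_mem_chrs ⟨s, (K.equiv a).refl s, rfl⟩, fun a _ => ?_, fun a _ => ?_⟩
  · rw [forall_mem_chrs]
    rintro _ ⟨t, -, rfl⟩ ψ hψ
    rw [provesS5_chr_ty_imp_iff (isBounded_of_mem_subs ψ hψ),
      provesS5_chr_ty_imp_iff (ψ := neg ψ) (isBounded_of_mem_subs ψ hψ)]
    exact em _
  · rw [forall_mem_chrs]
    rintro _ ⟨t, r, rfl⟩ ψ hψ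
    have hbox : (box a ψ).IsBounded Q k := isBounded_of_mem_subs _ hψ
    have hsub : ψ.IsBounded Q k :=
      hbox.of_mem_subs (Set.mem_insert_of_mem _ ψ.mem_subs_self)
    simp only [provesS5_chr_ty_imp_iff hbox, forall_mem_chrs, Model.mem_ty_succ, Sat,
      forall_exists_index, and_imp, forall_apply_eq_imp_iff₂, provesS5_chr_ty_imp_iff hsub]
    exact forall_congr' fun t' => imp_congr_left
      ⟨(K.equiv a).trans r, (K.equiv a).trans ((K.equiv a).symm r)⟩

/-- A modal formula that says that the current world has a refinement of type `τ`: its atoms are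
those of `τ`, and each type that an agent considers possible in `τ` is the type of a refinement
of a world that the agent considers possible. -/
noncomputable def refinable : (k : ℕ) → Ty Q A k → ModalForm P A
  | 0, τ => chr 0 τ
  | k + 1, τ => and (refinable k τ.1)
      (bigAnd Finset.univ fun a => bigDia a (τ.2 a) (refinable k))

open Form in
theorem refinable_of_someRef_chr [Nonempty A] (hQ : Classical.arbitrary P ∈ Q) {τ : Ty Q A k}
    (hτ : τ.Realizable) {v : Form P A → Prop} (hv : IsMCS v)
    (h : v (someRef (ofModal (chr k τ)))) : v (ofModal (refinable k τ)) := by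
  induction k generalizing v with
  | zero =>
    have hneg : (Form.neg (ofModal (chr 0 τ))).IsProp := isProp_ofModal_chr_zero τ
    rw [someRef, hv.neg_iff, hv.iff_of_provable (.axRP hneg), hv.neg_iff, not_not] at h
    exact h
  | succ k ih =>
    have hexplicit : Explicit Set.univ (chr k τ.1) fun a => chrs (τ.2 a) := by
      obtain ⟨K, s, rfl⟩ := hτ
      exact explicit_chr hQ s
    simp only [chr_succ, ofModal, ofModal_bigAnd, ofModal_cover,
      hv.iff_of_provable (.axRDist _ _ hexplicit), hv.bigAnd_iff, Finset.mem_univ, forall_const,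
      hv.iff_of_provable (.axRS5 _ _ _ (hexplicit.mono (Set.subset_univ _))), hv.and_iff,
      forall_mem_chrs] at h
    simp only [refinable, bigDia, ofModal, ofModal_bigAnd, hv.and_iff, hv.bigAnd_iff,
      Finset.mem_univ, forall_const, Set.Finite.mem_toFinset]
    exact ⟨ih hτ.fst hv (h (Classical.arbitrary A)).1, fun a σ hσ =>
      hv.dia_mono (fun w hw => ih (hτ.of_mem hσ) hw) ((h a).2 σ hσ)⟩

end Ty

/-! ## Bounded morphisms and the results of executing action models -/

/-- Bounded morphisms of Kripke models. -/
structure IsBoundedMorphism {P : Type u} {A : Type v} (K K' : Model P A) (f : K.W → K'.W) :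
    Prop where
  val : ∀ p s, K.V p s ↔ K'.V p (f s)
  forth : ∀ a s t, K.R a s t → K'.R a (f s) (f t)
  back : ∀ a s t', K'.R a (f s) t' → ∃ t, K.R a s t ∧ f t = t'

namespace IsBoundedMorphism

variable {P : Type u} {A : Type v} {K K' : Model P A} {f : K.W → K'.W}

theorem sat_iff (h : IsBoundedMorphism K K' f) (φ : ModalForm P A) (s : K.W) :
    φ.Sat K s ↔ φ.Sat K' (f s) := by
  induction φ generalizing s with
  | atom p => exact h.val p s
  | neg φ ih => exact not_congr (ih s)
  | and φ ψ ihφ ihψ => exact and_congr (ihφ s) (ihψ s)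
  | box a φ ih =>
    constructor
    · intro hs t' r
      obtain ⟨t, r', rfl⟩ := h.back a s t' r
      exact (ih t).1 (hs t r')
    · exact fun hs t r => (ih t).2 (hs _ (h.forth a s t r))

theorem ty_eq (h : IsBoundedMorphism K K' f) (Q : Finset P) (k : ℕ) (s : K.W) :
    K.ty Q k s = K'.ty Q k (f s) := by
  induction k generalizing s with
  | zero => exact congrArg ULift.up (Set.ext fun q => h.val q s)
  | succ k ih =>
    refine Prod.ext (ih s) (funext fun a => Set.ext fun σ => ?_)
    simp only [Model.mem_ty_succ]
    constructor
    · rintro ⟨t, r, rfl⟩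
      exact ⟨f t, h.forth a s t r, (ih t).symm⟩
    · rintro ⟨t', r, rfl⟩
      obtain ⟨t, r', rfl⟩ := h.back a s t' r
      exact ⟨t, r', ih t⟩

end IsBoundedMorphism

namespace ActModel

variable {P : Type u} {A : Type v} {Q : Finset P} {M N : ActModel P A} {K : Model P A} {s : K.W}
  {k d : ℕ}

/-- The types of the results of executing `M` at `s`. -/
def post (Q : Finset P) (M : ActModel P A) (K : Model P A) (s : K.W) (k : ℕ) : Set (Ty Q A k) :=
  {σ | ∃ t ∈ M.pts, ∃ h : (M.pre t).Sat K s, (M.exec K).ty Q k ⟨(s, t), h⟩ = σ}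

theorem mem_post_iff_exists_succ {σ : Ty Q A k} :
    σ ∈ M.post Q K s k ↔ ∃ τ ∈ M.post Q K s (k + 1), τ.1 = σ :=
  ⟨fun ⟨t, ht, h, e⟩ => ⟨_, ⟨t, ht, h, rfl⟩, e⟩,
    fun ⟨_, ⟨t, ht, h, e⟩, e'⟩ => ⟨t, ht, h, (congrArg Prod.fst e).trans e'⟩⟩

theorem isBoundedMorphism_inl (M N : ActModel P A) (K : Model P A) :
    IsBoundedMorphism (M.exec K) ((M.choice N).exec K)
      fun x => ⟨(x.1.1, Sum.inl x.1.2), x.2⟩ where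
  val _ _ := Iff.rfl
  forth _ _ _ r := ⟨r.1, .inl r.2⟩
  back := by
    rintro a x ⟨⟨s', _⟩, h⟩ ⟨r, r'⟩
    obtain ⟨r'⟩ | _ := r'
    exact ⟨⟨(s', _), h⟩, ⟨r, r'⟩, rfl⟩

theorem isBoundedMorphism_inr (M N : ActModel P A) (K : Model P A) :
    IsBoundedMorphism (N.exec K) ((M.choice N).exec K)
      fun x => ⟨(x.1.1, Sum.inr x.1.2), x.2⟩ where
  val _ _ := Iff.rfl
  forth _ _ _ r := ⟨r.1, .inr r.2⟩
  back := by
    rintro a x ⟨⟨s', _⟩, h⟩ ⟨r, r'⟩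
    obtain _ | ⟨r'⟩ := r'
    exact ⟨⟨(s', _), h⟩, ⟨r, r'⟩, rfl⟩

theorem post_choice (M N : ActModel P A) (K : Model P A) (s : K.W) (k : ℕ) :
    (M.choice N).post Q K s k = M.post Q K s k ∪ N.post Q K s k := by
  ext σ
  constructor
  · rintro ⟨_, ⟨t, ht, rfl⟩ | ⟨t, ht, rfl⟩, h, rfl⟩
    · exact .inl ⟨t, ht, h, (isBoundedMorphism_inl M N K).ty_eq Q k ⟨(s, t), h⟩⟩
    · exact .inr ⟨t, ht, h, (isBoundedMorphism_inr M N K).ty_eq Q k ⟨(s, t), h⟩⟩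
  · rintro (⟨t, ht, h, rfl⟩ | ⟨t, ht, h, rfl⟩)
    · exact ⟨.inl t, .inl ⟨t, ht, rfl⟩, h,
        ((isBoundedMorphism_inl M N K).ty_eq Q k ⟨(s, t), h⟩).symm⟩
    · exact ⟨.inr t, .inr ⟨t, ht, rfl⟩, h,
        ((isBoundedMorphism_inr M N K).ty_eq Q k ⟨(s, t), h⟩).symm⟩

section Test

variable [Nonempty P] {χ : Form P A}

theorem isBoundedMorphism_test (χ : Form P A) (K : Model P A) :
    IsBoundedMorphism ((test χ).exec K) K fun x => x.1.1 where
  val _ _ := Iff.rfl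
  forth _ _ _ r := r.1
  back _ _ s' r := ⟨⟨(s', false), Form.sat_top⟩, ⟨r, trivial⟩, rfl⟩

theorem mem_post_test {σ : Ty Q A k} :
    σ ∈ (test χ).post Q K s k ↔ χ.Sat K s ∧ K.ty Q k s = σ := by
  have key := (isBoundedMorphism_test χ K).ty_eq Q k
  constructor
  · rintro ⟨_, rfl, h, rfl⟩
    exact ⟨h, (key ⟨(s, true), h⟩).symm⟩
  · rintro ⟨h, rfl⟩
    exact ⟨true, rfl, h, key ⟨(s, true), h⟩⟩

theorem sat_pre_test_seq {i : Bool} {t : M.frame.pt} :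
    (((test χ).seq M).pre (i, t)).Sat K s ↔ ((test χ).pre i).Sat K s ∧ (M.pre t).Sat K s := by
  have sat_pre_iff (x : ((test χ).exec K).W) :
      (M.pre t).Sat ((test χ).exec K) x ↔ (M.pre t).Sat K x.1.1 := by
    rw [← Form.sat_reduce, ← Form.sat_reduce]
    exact (isBoundedMorphism_test χ K).sat_iff _ x
  exact Form.sat_someAct_pt.trans
    ⟨fun ⟨h, h'⟩ => ⟨h, (sat_pre_iff ⟨(s, i), h⟩).1 h'⟩,
      fun ⟨h, h'⟩ => ⟨h, (sat_pre_iff ⟨(s, i), h⟩).2 h'⟩⟩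

theorem isBoundedMorphism_test_seq (χ : Form P A) (M : ActModel P A) (K : Model P A) :
    IsBoundedMorphism (((test χ).seq M).exec K) (M.exec K)
      fun x => ⟨(x.1.1, x.1.2.2), (sat_pre_test_seq.1 x.2).2⟩ where
  val _ _ := Iff.rfl
  forth _ _ _ r := ⟨r.1, r.2.2⟩
  back _ _ y r := ⟨⟨(y.1.1, (false, y.1.2)), sat_pre_test_seq.2 ⟨Form.sat_top, y.2⟩⟩,
    ⟨r.1, trivial, r.2⟩, rfl⟩

theorem mem_post_test_seq {σ : Ty Q A k} :
    σ ∈ ((test χ).seq M).post Q K s k ↔ χ.Sat K s ∧ σ ∈ M.post Q K s k := by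
  have key := (isBoundedMorphism_test_seq χ M K).ty_eq Q k
  constructor
  · rintro ⟨⟨_, t⟩, ⟨rfl, ht⟩, h, rfl⟩
    have hpre := sat_pre_test_seq.1 h
    exact ⟨hpre.1, t, ht, hpre.2, (key ⟨(s, _, t), h⟩).symm⟩
  · rintro ⟨hχ, t, ht, h, rfl⟩
    have hpre : (((test χ).seq M).pre (true, t)).Sat K s := sat_pre_test_seq.2 ⟨hχ, h⟩
    exact ⟨(true, t), ⟨rfl, ht⟩, hpre, key ⟨(s, true, t), hpre⟩⟩

end Test

section Learn

variable {B : Set A} {a b : A} {τ₀ : Ty Q A (d + 1)}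

/-- A point of the result of learning is sent to itself if it is not a proxy, and to the point that
it is the proxy of otherwise. -/
def learnBase (x : ((learn B M N).exec K).W) : ((M.choice N).exec K).W :=
  ⟨(x.1.1, LearnPt.base x.1.2), x.2⟩

/-- Whenever `U` can be executed, the types of depth `d` of the results of `U` at the worlds that
an agent in `B` considers possible are the types that the agent considers possible in `τ₀`. -/
def ResultsIn (B : Set A) (U : ActModel P A) (K : Model P A) (τ₀ : Ty Q A (d + 1)) : Prop :=
  ∀ b ∈ B, ∀ s, (U.post Q K s d).Nonempty →
    {σ | ∃ s', K.R b s s' ∧ σ ∈ U.post Q K s' d} = τ₀.2 b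

theorem ty_learn_snd_of_notMem
    (ih : ∀ x : ((learn B M N).exec K).W,
      ((learn B M N).exec K).ty Q k x = ((M.choice N).exec K).ty Q k (learnBase x))
    (ha : a ∉ B) (x : ((learn B M N).exec K).W) :
    (((learn B M N).exec K).ty Q (k + 1) x).2 a =
      (((M.choice N).exec K).ty Q (k + 1) (learnBase x)).2 a := by
  ext σ
  simp only [Model.mem_ty_succ]
  constructor
  · rintro ⟨y, ⟨r, ⟨ha', _⟩ | ⟨_, r'⟩⟩, rfl⟩
    · exact absurd ha' ha
    · exact ⟨learnBase y, ⟨r, r'⟩, (ih y).symm⟩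
  · rintro ⟨⟨⟨s', t⟩, h⟩, ⟨r, r'⟩, rfl⟩
    exact ⟨⟨(s', .inl t), h⟩, ⟨r, .inr ⟨ha, r'⟩⟩, ih ⟨(s', .inl t), h⟩⟩

theorem ty_learn_snd_inl
    (ih : ∀ x : ((learn B M N).exec K).W,
      ((learn B M N).exec K).ty Q k x = ((M.choice N).exec K).ty Q k (learnBase x))
    (hb : b ∈ B) {t : (M.choice N).frame.pt} (h : ((M.choice N).pre t).Sat K s) :
    (((learn B M N).exec K).ty Q (k + 1) ⟨(s, .inl t), h⟩).2 b =
      (((M.choice N).exec K).ty Q (k + 1) ⟨(s, t), h⟩).2 b := by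
  ext σ
  constructor
  · rintro ⟨⟨⟨s', _⟩, h'⟩, ⟨r, ⟨_, r'⟩ | ⟨hb', _⟩⟩, rfl⟩
    · obtain r' | _ := r'
      exact ⟨⟨(s', _), h'⟩, ⟨r, r'⟩, (ih ⟨(s', _), h'⟩).symm⟩
    · exact absurd hb hb'
  · rintro ⟨⟨⟨s', t'⟩, h'⟩, ⟨r, r'⟩, rfl⟩
    exact ⟨⟨(s', .inl t'), h'⟩, ⟨r, .inl ⟨hb, .inl r'⟩⟩, ih ⟨(s', .inl t'), h'⟩⟩

theorem ty_learn_snd_inr {K₀ : Model P A} {s₀ : K₀.W}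
    (H : ResultsIn B (M.choice N) K (K₀.ty Q (d + 1) s₀)) (hk : k ≤ d)
    (ih : ∀ x : ((learn B M N).exec K).W,
      ((learn B M N).exec K).ty Q k x = ((M.choice N).exec K).ty Q k (learnBase x))
    (hb : b ∈ B) (t : {t // t ∈ (M.choice N).pts}) (h : ((M.choice N).pre t.1).Sat K s) :
    (((learn B M N).exec K).ty Q (k + 1) ⟨(s, .inr t), h⟩).2 b = (K₀.ty Q (k + 1) s₀).2 b := by
  have mem_class {σ : Ty Q A d} := Set.ext_iff.1 (H b hb s ⟨_, t.1, t.2, h, rfl⟩) σ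
  ext σ
  simp only [Model.mem_ty_succ]
  constructor
  · rintro ⟨⟨⟨s', _⟩, h'⟩, ⟨r, ⟨_, r'⟩ | ⟨hb', _⟩⟩, rfl⟩
    · obtain _ | @⟨_, y, _⟩ := r'
      obtain ⟨z, rz, e⟩ := mem_class.1 ⟨s', r, y.1, y.2, h', rfl⟩
      exact ⟨z, rz, (Model.ty_eq_of_le hk e).trans (ih ⟨(s', .inr y), h'⟩).symm⟩
    · exact absurd hb hb'
  · rintro ⟨z, rz, rfl⟩
    obtain ⟨s', r, t', ht', h', e⟩ := mem_class.2 ⟨z, rz, rfl⟩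
    exact ⟨⟨(s', .inr ⟨t', ht'⟩), h'⟩, ⟨r, .inl ⟨hb, .inr trivial⟩⟩,
      (ih ⟨(s', .inr ⟨t', ht'⟩), h'⟩).trans (Model.ty_eq_of_le hk e)⟩

theorem ty_learn (H : ResultsIn B (M.choice N) K τ₀) (hτ₀ : τ₀.Realizable) (hk : k ≤ d)
    (x : ((learn B M N).exec K).W) :
    ((learn B M N).exec K).ty Q k x = ((M.choice N).exec K).ty Q k (learnBase x) := by
  obtain ⟨K₀, s₀, rfl⟩ := hτ₀
  induction k generalizing x with
  | zero => rfl
  | succ k ih =>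
    have ih := ih (by omega)
    refine Prod.ext (ih x) (funext fun a => ?_)
    by_cases ha : a ∈ B
    · obtain ⟨⟨s, t | t⟩, h⟩ := x
      · exact ty_learn_snd_inl ih ha h
      · -- The base of the proxy has the type of a world `z` in the class of `s₀`.
        obtain ⟨z, rz, e⟩ : ((M.choice N).exec K).ty Q d ⟨(s, t.1), h⟩ ∈
            (K₀.ty Q (d + 1) s₀).2 a := by
          rw [← H a ha s ⟨_, t.1, t.2, h, rfl⟩]
          exact ⟨s, (K.equiv a).refl s, t.1, t.2, h, rfl⟩
        calc (((learn B M N).exec K).ty Q (k + 1) ⟨(s, .inr t), h⟩).2 a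
            = (K₀.ty Q (k + 1) s₀).2 a := ty_learn_snd_inr H (by omega) ih ha t h
          _ = (K₀.ty Q (k + 1) z).2 a := Model.ty_succ_snd_eq k rz
          _ = _ := by rw [Model.ty_eq_of_le hk e]; rfl
    · exact ty_learn_snd_of_notMem ih ha x

open Classical in
theorem post_learn (H : ResultsIn B (M.choice N) K τ₀) (hτ₀ : τ₀.Realizable) (s : K.W) :
    (learn B M N).post Q K s (d + 1) =
      (fun τ => ((τ.1, B.piecewise τ₀.2 τ.2) : Ty Q A (d + 1))) '' M.post Q K s (d + 1) := by
  have ty_proxy (t : M.frame.pt) (ht : t ∈ M.pts) (h : (M.pre t).Sat K s) :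
      ((learn B M N).exec K).ty Q (d + 1)
        ⟨(s, .inr ⟨.inl t, Or.inl (Set.mem_image_of_mem Sum.inl ht)⟩), h⟩ =
      (((M.exec K).ty Q (d + 1) ⟨(s, t), h⟩).1,
        B.piecewise τ₀.2 ((M.exec K).ty Q (d + 1) ⟨(s, t), h⟩).2) := by
    have ih := fun x => ty_learn H hτ₀ le_rfl x
    rw [(isBoundedMorphism_inl M N K).ty_eq Q (d + 1) ⟨(s, t), h⟩]
    refine Prod.ext (ih _) (funext fun a => ?_)
    by_cases ha : a ∈ B
    · obtain ⟨K₀, s₀, rfl⟩ := hτ₀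
      exact (ty_learn_snd_inr H le_rfl ih ha
        ⟨.inl t, Or.inl (Set.mem_image_of_mem Sum.inl ht)⟩ h).trans
          (Set.piecewise_eq_of_mem _ _ _ ha).symm
    · exact (ty_learn_snd_of_notMem ih ha _).trans (Set.piecewise_eq_of_notMem _ _ _ ha).symm
  ext σ
  constructor
  · rintro ⟨_, ⟨t, ht, rfl⟩, h, rfl⟩
    exact ⟨_, ⟨t, ht, h, rfl⟩, (ty_proxy t ht h).symm⟩
  · rintro ⟨_, ⟨t, ht, h, rfl⟩, rfl⟩
    exact ⟨_, ⟨t, ht, rfl⟩, h, ty_proxy t ht h⟩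

end Learn

end ActModel

/-! ## Synthesis of action formulae -/

/-- The inclusion of the modal language in the language of arbitrary action formula logic. -/
def AFForm.ofModal {P : Type u} {A : Type v} : ModalForm P A → AFForm P A
  | .atom p => .atom p
  | .neg φ => .neg (ofModal φ)
  | .and φ ψ => .and (ofModal φ) (ofModal ψ)
  | .box a φ => .box a (ofModal φ)

theorem AFForm.refFree_ofModal {P : Type u} {A : Type v} (m : ModalForm P A) :
    (ofModal m).RefFree := by
  induction m <;> simp_all only [ofModal, RefFree, and_self]

section

variable {P : Type u} {A : Type v} [Nonempty P]

theorem AFForm.toForm_ofModal (m : ModalForm P A) : (ofModal m).toForm = Form.ofModal m := by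
  induction m <;> simp_all only [ofModal, toForm, Form.ofModal]

mutual

theorem AFForm.refFree_toForm : (φ : AFForm P A) → φ.RefFree → φ.toForm.RefFree
  | .atom _, _ => by
    rw [AFForm.toForm]
    trivial
  | .neg φ, h => by
    rw [AFForm.RefFree] at h
    rw [AFForm.toForm]
    exact AFForm.refFree_toForm φ h
  | .and φ ψ, h => by
    rw [AFForm.RefFree] at h
    rw [AFForm.toForm]
    exact ⟨AFForm.refFree_toForm φ h.1, AFForm.refFree_toForm ψ h.2⟩
  | .box _ φ, h => by
    rw [AFForm.RefFree] at h
    rw [AFForm.toForm]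
    exact AFForm.refFree_toForm φ h
  | .allAct α φ, h => by
    rw [AFForm.RefFree] at h
    rw [AFForm.toForm]
    exact ⟨AFAct.refFree_pre α h.1, AFForm.refFree_toForm φ h.2⟩
  | .allRef _, h => by
    rw [AFForm.RefFree] at h
    exact h.elim

theorem AFAct.refFree_pre :
    (α : AFAct P A) → α.RefFree → ∀ t : α.toModel.frame.pt, (α.toModel.pre t).RefFree
  | .test φ, h => by
    rw [AFAct.RefFree] at h
    rw [AFAct.toModel]
    rintro (_ | _)
    · exact ⟨trivial, trivial⟩
    · exact AFForm.refFree_toForm φ h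
  | .choice α β, h => by
    rw [AFAct.RefFree] at h
    rw [AFAct.toModel]
    exact Sum.rec (AFAct.refFree_pre α h.1) (AFAct.refFree_pre β h.2)
  | .seq α β, h => by
    rw [AFAct.RefFree] at h
    rw [AFAct.toModel]
    exact fun t => ⟨AFAct.refFree_pre α h.1, AFAct.refFree_pre β h.2 t.2⟩
  | .learn _ _ α β, h => by
    rw [AFAct.RefFree] at h
    rw [AFAct.toModel]
    have hpre : ∀ t, ((α.toModel.choice β.toModel).pre t).RefFree :=
      Sum.rec (AFAct.refFree_pre α h.1) (AFAct.refFree_pre β h.2)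
    exact fun x => hpre x.base

end

end

namespace AFAct

open ModalForm Ty

variable {P : Type u} {A : Type v} {m : ModalForm P A} {α : AFAct P A}

/-- The action formula `?m ⊗ α`, which restricts the execution of `α` to the worlds at which the
modal formula `m` is true. -/
def guard (m : ModalForm P A) (α : AFAct P A) : AFAct P A := .seq (.test (.ofModal m)) α

theorem refFree_guard (hα : α.RefFree) : (guard m α).RefFree := by
  rw [guard, RefFree, RefFree]
  exact ⟨AFForm.refFree_ofModal m, hα⟩

variable [Nonempty P] {Q : Finset P} {K : Model P A} {s : K.W} {k : ℕ} {ι : Type*}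

/-- The choice between the action formulae `f i` for `i` in a set; the empty choice is a test that
always fails. -/
noncomputable def bigChoice [Finite ι] (S : Set ι) (f : ι → AFAct P A) : AFAct P A :=
  (S.toFinite.toFinset.toList.map f).foldr .choice (.test (.ofModal .bot))

theorem refFree_bigChoice [Finite ι] {S : Set ι} {f : ι → AFAct P A} (hf : ∀ i, (f i).RefFree) :
    (bigChoice S f).RefFree := by
  rw [bigChoice]
  induction S.toFinite.toFinset.toList with
  | nil =>
    rw [List.map_nil, List.foldr_nil, RefFree]
    exact AFForm.refFree_ofModal _
  | cons i l ih =>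
    rw [List.map_cons, List.foldr_cons, RefFree]
    exact ⟨hf i, ih⟩

theorem mem_post_test_ofModal {σ : Ty Q A k} :
    σ ∈ (AFAct.test (.ofModal m)).toModel.post Q K s k ↔ m.Sat K s ∧ K.ty Q k s = σ := by
  rw [toModel, ActModel.mem_post_test, AFForm.toForm_ofModal, Form.sat_ofModal]

theorem mem_post_guard {σ : Ty Q A k} :
    σ ∈ (guard m α).toModel.post Q K s k ↔ m.Sat K s ∧ σ ∈ α.toModel.post Q K s k := by
  rw [guard, toModel, toModel, ActModel.mem_post_test_seq, AFForm.toForm_ofModal,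
    Form.sat_ofModal]

theorem mem_post_bigChoice [Finite ι] {S : Set ι} {f : ι → AFAct P A} {σ : Ty Q A k} :
    σ ∈ (bigChoice S f).toModel.post Q K s k ↔ ∃ i ∈ S, σ ∈ (f i).toModel.post Q K s k := by
  have hbot : ¬ σ ∈ (AFAct.test (.ofModal .bot)).toModel.post Q K s k := fun h =>
    (mem_post_test_ofModal.1 h).1 ModalForm.sat_top
  rw [bigChoice, foldr_or_iff (v := fun α : AFAct P A => σ ∈ α.toModel.post Q K s k)
    (fun α β => by rw [toModel, ActModel.post_choice, Set.mem_union]) hbot]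
  simp only [List.mem_map, exists_exists_and_eq_and, Finset.mem_toList, Set.Finite.mem_toFinset]

variable [Fintype A] {f : Ty Q A k → AFAct P A}

/-- `α` can be executed exactly at the worlds that have a refinement of type `τ`, and its results
have that type. -/
def Synthesises (α : AFAct P A) (τ : Ty Q A k) : Prop :=
  ∀ (K : Model P A) (s : K.W) (ρ : Ty Q A k),
    ρ ∈ α.toModel.post Q K s k ↔ ρ = τ ∧ (refinable k τ).Sat K s

/-- The action formula that executes `α` and makes `b` consider possible the results of exactly the
`f σ` with `σ ∈ C`. It tests beforehand, in both alternatives, that each of these can be executed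
at some world that `b` considers possible. -/
noncomputable def confine (f : Ty Q A k → AFAct P A) (b : A) (C : Set (Ty Q A k))
    (α : AFAct P A) : AFAct P A :=
  .learn {b} (Set.singleton_nonempty b) (guard (bigDia b C (refinable k)) α)
    (guard (bigDia b C (refinable k)) (bigChoice C f))

theorem refFree_confine (hf : ∀ σ, (f σ).RefFree) (hα : α.RefFree) {b : A}
    {C : Set (Ty Q A k)} : (confine f b C α).RefFree := by
  rw [confine, RefFree]
  exact ⟨refFree_guard hα, refFree_guard (refFree_bigChoice hf)⟩

variable {τ : Ty Q A (k + 1)} {b : A}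

theorem resultsIn_confine (hf : ∀ σ ∈ τ.2 b, (f σ).Synthesises σ)
    (hα : ∀ (K : Model P A) s, α.toModel.post Q K s k ⊆ τ.2 b) (K : Model P A) :
    ActModel.ResultsIn {b} ((guard (bigDia b (τ.2 b) (refinable k)) α).toModel.choice
      (guard (bigDia b (τ.2 b) (refinable k)) (bigChoice (τ.2 b) f)).toModel) K τ := by
  rintro _ rfl s ⟨ρ, hρ⟩
  simp only [ActModel.post_choice, Set.mem_union, mem_post_guard, mem_post_bigChoice,
    ← and_or_left] at hρ ⊢
  obtain ⟨hs, -⟩ := hρ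
  ext σ
  constructor
  · rintro ⟨s', -, -, hσ | ⟨σ', hσ', hσ⟩⟩
    · exact hα K s' hσ
    · obtain ⟨rfl, -⟩ := (hf σ' hσ' K s' σ).1 hσ
      exact hσ'
  · intro hσ
    obtain ⟨s', r, hs'⟩ := sat_bigDia.1 hs σ hσ
    exact ⟨s', r, (sat_bigDia_congr r).1 hs, .inr ⟨σ, hσ, (hf σ hσ K s' σ).2 ⟨rfl, hs'⟩⟩⟩

open Classical in
theorem mem_post_confine (hτ : τ.Realizable) (hf : ∀ σ ∈ τ.2 b, (f σ).Synthesises σ)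
    (hα : ∀ (K : Model P A) s, α.toModel.post Q K s k ⊆ τ.2 b) {σ : Ty Q A (k + 1)} :
    σ ∈ (confine f b (τ.2 b) α).toModel.post Q K s (k + 1) ↔
      (bigDia b (τ.2 b) (refinable k)).Sat K s ∧
        ∃ ρ ∈ α.toModel.post Q K s (k + 1), (ρ.1, Function.update ρ.2 b (τ.2 b)) = σ := by
  rw [confine, toModel, ActModel.post_learn (resultsIn_confine hf hα K) hτ]
  simp only [Set.piecewise_singleton]
  constructor
  · rintro ⟨ρ, hρ, rfl⟩
    obtain ⟨hs, hρ⟩ := mem_post_guard.1 hρ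
    exact ⟨hs, ρ, hρ, rfl⟩
  · rintro ⟨hs, ρ, hρ, rfl⟩
    exact ⟨ρ, mem_post_guard.2 ⟨hs, hρ⟩, rfl⟩

/-- The action formula that results from `f τ.1` by confining the agents in a list to the types
that they consider possible in `τ`. -/
noncomputable def confineAll (f : Ty Q A k → AFAct P A) (τ : Ty Q A (k + 1)) (l : List A) :
    AFAct P A :=
  l.foldr (fun b => confine f b (τ.2 b)) (f τ.1)

theorem refFree_confineAll (hf : ∀ σ, (f σ).RefFree) (l : List A) :
    (confineAll f τ l).RefFree := by
  induction l with
  | nil => exact hf _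
  | cons b l ih => exact refFree_confine hf ih

section ConfineAll

variable (hτ : τ.Realizable) (hf : ∀ σ : Ty Q A k, σ.Realizable → (f σ).Synthesises σ)
  {l : List A}

include hτ hf

theorem eq_of_mem_post_confineAll {ρ : Ty Q A k}
    (hρ : ρ ∈ (confineAll f τ l).toModel.post Q K s k) : ρ = τ.1 := by
  induction l generalizing K s ρ with
  | nil => exact ((hf _ hτ.fst K s ρ).1 hρ).1
  | cons b l ih =>
    obtain ⟨_, hσ, rfl⟩ := ActModel.mem_post_iff_exists_succ.1 hρ
    obtain ⟨-, σ, hσ', rfl⟩ := (mem_post_confine hτ (fun σ hσ => hf σ (hτ.of_mem hσ))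
      fun K s ρ hρ => ih hρ ▸ hτ.fst_mem b).1 hσ
    exact ih (ActModel.mem_post_iff_exists_succ.2 ⟨σ, hσ', rfl⟩)

open Classical in
theorem mem_post_confineAll_cons {σ : Ty Q A (k + 1)} :
    σ ∈ (confineAll f τ (b :: l)).toModel.post Q K s (k + 1) ↔
      (bigDia b (τ.2 b) (refinable k)).Sat K s ∧
        ∃ ρ ∈ (confineAll f τ l).toModel.post Q K s (k + 1),
          (ρ.1, Function.update ρ.2 b (τ.2 b)) = σ :=
  mem_post_confine hτ (fun σ hσ => hf σ (hτ.of_mem hσ)) fun _ _ _ hρ =>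
    eq_of_mem_post_confineAll hτ hf hρ ▸ hτ.fst_mem b

theorem snd_eq_of_mem_post_confineAll {ρ : Ty Q A (k + 1)}
    (hρ : ρ ∈ (confineAll f τ l).toModel.post Q K s (k + 1)) {a : A} (ha : a ∈ l) :
    ρ.2 a = τ.2 a := by
  classical
  induction l generalizing ρ with
  | nil => exact absurd ha List.not_mem_nil
  | cons b l ih =>
    obtain ⟨-, σ, hσ, rfl⟩ := (mem_post_confineAll_cons hτ hf).1 hρ
    obtain rfl | hab := eq_or_ne a b
    · exact Function.update_self a (τ.2 a) σ.2
    · exact (Function.update_of_ne hab (τ.2 b) σ.2).trans (ih hσ (List.mem_of_ne_of_mem hab ha))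

theorem post_confineAll_nonempty :
    ((confineAll f τ l).toModel.post Q K s (k + 1)).Nonempty ↔
      (refinable k τ.1).Sat K s ∧ ∀ a ∈ l, (bigDia a (τ.2 a) (refinable k)).Sat K s := by
  induction l with
  | nil =>
    have hpost := hf τ.1 hτ.fst K s
    simp only [List.not_mem_nil, IsEmpty.forall_iff, implies_true, and_true]
    constructor
    · rintro ⟨ρ, hρ⟩
      exact ((hpost ρ.1).1 (ActModel.mem_post_iff_exists_succ.2 ⟨ρ, hρ, rfl⟩)).2
    · intro hs
      obtain ⟨ρ, hρ, -⟩ := ActModel.mem_post_iff_exists_succ.1 ((hpost τ.1).2 ⟨rfl, hs⟩)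
      exact ⟨ρ, hρ⟩
  | cons b l ih =>
    rw [List.forall_mem_cons, and_left_comm, ← ih]
    constructor
    · rintro ⟨_, h⟩
      obtain ⟨hs, ρ, hρ, -⟩ := (mem_post_confineAll_cons hτ hf).1 h
      exact ⟨hs, ρ, hρ⟩
    · rintro ⟨hs, ρ, hρ⟩
      exact ⟨_, (mem_post_confineAll_cons hτ hf).2 ⟨hs, ρ, hρ, rfl⟩⟩

end ConfineAll

/-- The action formula that synthesises a type. -/
noncomputable def synth : (k : ℕ) → Ty Q A k → AFAct P A
  | 0, τ => .test (.ofModal (chr 0 τ))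
  | k + 1, τ => confineAll (synth k) τ Finset.univ.toList

theorem refFree_synth (τ : Ty Q A k) : (synth k τ).RefFree := by
  induction k with
  | zero =>
    rw [synth, RefFree]
    exact AFForm.refFree_ofModal _
  | succ k ih => exact refFree_confineAll ih _

theorem synthesises_synth {τ : Ty Q A k} (hτ : τ.Realizable) : (synth k τ).Synthesises τ := by
  induction k with
  | zero =>
    intro K s ρ
    rw [synth, mem_post_test_ofModal, sat_chr, refinable, sat_chr]
    exact ⟨fun ⟨h, h'⟩ => ⟨h'.symm.trans h, h⟩, fun ⟨h, h'⟩ => ⟨h', h'.trans h.symm⟩⟩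
  | succ k ih =>
    intro K s ρ
    have nonempty_iff : ((synth (k + 1) τ).toModel.post Q K s (k + 1)).Nonempty ↔
        (refinable (k + 1) τ).Sat K s := by
      rw [synth, post_confineAll_nonempty hτ @ih]
      simp only [Finset.mem_toList, refinable, ModalForm.Sat, sat_bigAnd]
    have eq_of_mem {ρ : Ty Q A (k + 1)}
        (hρ : ρ ∈ (synth (k + 1) τ).toModel.post Q K s (k + 1)) : ρ = τ :=
      Prod.ext
        (eq_of_mem_post_confineAll hτ @ih (ActModel.mem_post_iff_exists_succ.2 ⟨ρ, hρ, rfl⟩))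
        (funext fun a => snd_eq_of_mem_post_confineAll hτ @ih hρ
          (Finset.mem_toList.2 (Finset.mem_univ a)))
    constructor
    · exact fun hρ => ⟨eq_of_mem hρ, nonempty_iff.1 ⟨ρ, hρ⟩⟩
    · rintro ⟨rfl, hs⟩
      obtain ⟨ρ', hρ'⟩ := nonempty_iff.2 hs
      rwa [eq_of_mem hρ'] at hρ'

end AFAct

/-! ## Making a formula true -/

namespace ModalForm

variable {P : Type u} {A : Type v} {Q : Finset P} {k : ℕ}

/-- The types of the worlds at which a modal formula is true. -/
def types (Q : Finset P) (k : ℕ) (m : ModalForm P A) : Set (Ty Q A k) :=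
  {σ | ∃ (K : Model P A) (s : K.W), K.ty Q k s = σ ∧ m.Sat K s}

theorem IsBounded.ty_mem_types_iff {m : ModalForm P A} (hm : m.IsBounded Q k) {K : Model P A}
    {s : K.W} : K.ty Q k s ∈ m.types Q k ↔ m.Sat K s :=
  ⟨fun ⟨_, _, e, h⟩ => (hm.sat_iff e).1 h, fun h => ⟨K, s, rfl, h⟩⟩

end ModalForm

variable {P : Type u} {A : Type v} [Nonempty P] [Fintype A] {Q : Finset P} {k : ℕ}

theorem Form.IsMCS.exists_someRef_chr {v : Form P A → Prop} (hv : IsMCS v) {φ : Form P A}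
    (hφ : φ.RefFree) (h : v (someRef φ)) :
    ∃ σ ∈ φ.reduce.types Q k, v (someRef (ofModal (Ty.chr k σ))) := by
  obtain ⟨w, hw, hvw, hwφ⟩ := hv.someRef_iff.1 h
  have hchr : w (ofModal (.bigOr (φ.reduce.types Q k).toFinite.toFinset (Ty.chr k))) := by
    refine hw.imp_of_sat hφ (refFree_ofModal _) (fun K s hs => ?_) hwφ
    rw [sat_ofModal, ModalForm.sat_bigOr]
    exact ⟨K.ty Q k s, (Set.Finite.mem_toFinset _).2 ⟨K, s, rfl, sat_reduce.2 hs⟩,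
      Ty.sat_chr.2 rfl⟩
  rw [ofModal_bigOr, hw.bigOr_iff] at hchr
  obtain ⟨σ, hσ, hwσ⟩ := hchr
  exact ⟨σ, (Set.Finite.mem_toFinset _).1 hσ, hv.someRef_iff.2 ⟨w, hw, hvw, hwσ⟩⟩

namespace AFAct

/-- The action formula that chooses between the types of the worlds at which `m` is true and
synthesises one of them. -/
noncomputable def achieve (Q : Finset P) (k : ℕ) (m : ModalForm P A) : AFAct P A :=
  bigChoice (m.types Q k) (synth k)

theorem refFree_achieve (m : ModalForm P A) : (achieve Q k m).RefFree :=
  refFree_bigChoice refFree_synth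

theorem mem_post_achieve {m : ModalForm P A} {K : Model P A} {s : K.W} {σ : Ty Q A k} :
    σ ∈ (achieve Q k m).toModel.post Q K s k ↔
      σ ∈ m.types Q k ∧ (Ty.refinable k σ).Sat K s := by
  rw [achieve, mem_post_bigChoice]
  constructor
  · rintro ⟨τ, ⟨K₀, s₀, e, h₀⟩, hσ⟩
    obtain ⟨rfl, hs⟩ := (synthesises_synth ⟨K₀, s₀, e⟩ K s σ).1 hσ
    exact ⟨⟨K₀, s₀, e, h₀⟩, hs⟩
  · rintro ⟨⟨K₀, s₀, e, h₀⟩, hs⟩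
    exact ⟨σ, ⟨K₀, s₀, e, h₀⟩, (synthesises_synth ⟨K₀, s₀, e⟩ K s σ).2 ⟨rfl, hs⟩⟩

variable {φ : Form P A} (hφ : φ.reduce.IsBounded Q k)

include hφ

theorem sat_allAct_achieve (K : Model P A) (s : K.W) :
    (Form.allAct (achieve Q k φ.reduce).toModel φ).Sat K s := by
  intro t ht h
  have ⟨hmem, _⟩ := mem_post_achieve.1 ⟨t, ht, h, rfl⟩
  exact Form.sat_reduce.1 (hφ.ty_mem_types_iff.1 hmem)

theorem sat_someAct_achieve {σ : Ty Q A k} (hσ : σ ∈ φ.reduce.types Q k) {K : Model P A} {s : K.W}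
    (hs : (Ty.refinable k σ).Sat K s) :
    (Form.someAct (achieve Q k φ.reduce).toModel φ).Sat K s := by
  obtain ⟨t, ht, h, rfl⟩ := mem_post_achieve.2 ⟨hσ, hs⟩
  exact Form.sat_someAct.2 ⟨t, ht, h, Form.sat_reduce.1 (hφ.ty_mem_types_iff.1 hσ)⟩

end AFAct

end AFL

open AFL in
theorem mainTheorem6_general {P : Type u} {A : Type v} [Nonempty P] [Fintype A] [Nonempty A]
    {φ : Form P A} (hφ : φ.RefFree) :
    ∃ α : AFAct P A, α.RefFree ∧ Provable (Form.allAct α.toModel φ) ∧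
      Provable ((Form.someRef φ).imp (Form.someAct α.toModel φ)) := by
  classical
  obtain ⟨Q₀, k, hbounded⟩ := φ.reduce.exists_isBounded
  let Q := insert (Classical.arbitrary P) Q₀
  replace hbounded : φ.reduce.IsBounded Q k := hbounded.mono (Finset.subset_insert _ _) le_rfl
  have hα : (AFAct.achieve Q k φ.reduce).RefFree := AFAct.refFree_achieve _
  have hpre := AFAct.refFree_pre _ hα
  refine ⟨_, hα, ?_, ?_⟩ <;> refine Form.provable_of_forall_isMCS fun v hv => ?_
  · exact hv.of_forall_sat ⟨hpre, hφ⟩ (AFAct.sat_allAct_achieve hbounded)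
  · rw [hv.imp_iff]
    intro h
    obtain ⟨σ, hσ, hvσ⟩ := hv.exists_someRef_chr (Q := Q) (k := k) hφ h
    have hσ' : σ.Realizable := have ⟨K, s, e, _⟩ := hσ; ⟨K, s, e⟩
    have hrefinable := Ty.refinable_of_someRef_chr (Finset.mem_insert_self _ _) hσ' hv hvσ
    exact hv.imp_of_sat (Form.refFree_ofModal _) ⟨hpre, hφ⟩
      (fun K s hs => AFAct.sat_someAct_achieve hbounded hσ (Form.sat_ofModal.1 hs)) hrefinable

theorem mainTheorem6 {P : Type u} {A : Type v} [Nonempty P] [Fintype A] [Nonempty A]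
    (φ : AFL.AFForm P A) (hφ : φ.RefFree) :
    ∃ α : AFL.AFAct P A, α.RefFree ∧
      (AFL.AFForm.allAct α φ).Proves ∧
      ((AFL.AFForm.someRef φ).imp (AFL.AFForm.someAct α φ)).Proves := by
  simpa only [AFL.AFForm.Proves, AFL.AFForm.imp, AFL.AFForm.someRef, AFL.AFForm.someAct,
    AFL.AFForm.toForm, AFL.Form.imp, AFL.Form.someRef, AFL.Form.someAct] using
    mainTheorem6_general (φ.refFree_toForm hφ)
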